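/- **Conventions.** A directed graph $E=(E^0,E^1,r,s)$ has countable sets of vertices and edges; a sink emits no edge, a source receives none. $C^*(E)$ is the universal $C^*$-algebra for Cuntz–Krieger $E$-families: mutually orthogonal projections $p_v$ ($v\in E^0$) and partial isometries $s_e$ ($e\in E^1$) with mutually orthogonal ranges such that $s_e^*s_e=p_{r(e)}$, $s_es_e^*\le p_{s(e)}$, and $p_v=\sum_{s(e)=v}s_es_e^*$ whenever $0<|s^{-1}(v)|<\infty$. A labelled graph $(E,\pi)$ is a directed graph with a map $\pi:E^1\to\mathcal A$. Let $\mathcal L(E,\pi)$ be the set of words $\pi(\lambda)=\pi(e_1)\cdots\pi(e_n)$ for paths $\lambda=e_1\cdots e_n$, $n\ge1$, and $\mathcal L^1(E,\pi)=\pi(E^1)$. For $A\subseteq E^0$ and $\alpha\in\mathcal L(E,\pi)$ put $r(A,\alpha)=\{r(\lambda):\pi(\lambda)=\alpha,\ s(\lambda)\in A\}$, $r(\alpha)=r(E^0,\alpha)$, $s(\alpha)=\{s(\lambda):\pi(\lambda)=\alpha\}$ and $L^1_A=\{a\in\mathcal L^1(E,\pi):A\cap s(a)\ne\emptyset\}$.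 A collection $\mathcal C\subseteq 2^{E^0}$ is accommodating if it contains $\emptyset$ and all $r(\alpha)$ and is closed under $A\mapsto r(A,\alpha)$, finite unions and finite intersections; $(E,\pi,\mathcal C)$ is then a labelled space. It is weakly left-resolving if $r(A,\alpha)\cap r(B,\alpha)=r(A\cap B,\alpha)$ for all $A,B\in\mathcal C$, $\alpha\in\mathcal L(E,\pi)$. In that case $C^*(E,\pi,\mathcal C)$ is the universal $C^*$-algebra generated by projections $p_A$ ($A\in\mathcal C$) and partial isometries $s_a$ ($a\in\mathcal L^1(E,\pi)$) such that $p_\emptyset=0$, $p_Ap_B=p_{A\cap B}$, $p_{A\cup B}=p_A+p_B-p_{A\cap B}$; $p_As_a=s_ap_{r(A,a)}$; $s_a^*s_a=p_{r(a)}$ and $s_a^*s_b=0$ for $a\neq b$; and $p_A=\sum_{a\in L^1_A}s_ap_{r(A,a)}s_a^*$ for every $A\in\mathcal C$ that contains no sink and for which $L^1_A$ is finite and nonempty. Let $\mathcal E^0$ be the smallest accommodating collection that contains all $r(\alpha)$, all $s(\alpha)$ and the singletons $\{v\}$ of the sources and sinks $v$ (written $\mathcal E^0_{\mathcal G}$,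 $\mathcal F^0$, $\mathcal E_s(\mathcal P)^0$ for the graphs $E_{\mathcal G}$, $F$, $E_s(\mathcal P)$ below). An ultragraph $\mathcal G=(G^0,\mathcal G^1,r,s)$ has countable sets of vertices and edges, $s:\mathcal G^1\to G^0$, and $r(e)\subseteq G^0$ nonempty for $e\in\mathcal G^1$. Let $\mathcal G^0$ be the smallest collection of subsets of $G^0$ that contains $\emptyset$, all $\{v\}$ ($v\in G^0$) and all $r(e)$, and is closed under finite unions and intersections. $C^*(\mathcal G)$ is the universal $C^*$-algebra generated by partial isometries $s_e$ with mutually orthogonal ranges and projections $p_A$ ($A\in\mathcal G^0$) with $p_\emptyset=0$, $p_Ap_B=p_{A\cap B}$, $p_{A\cup B}=p_A+p_B-p_{A\cap B}$, $s_e^*s_e=p_{r(e)}$, $s_es_e^*\le p_{\{s(e)\}}$, and $p_{\{v\}}=\sum_{s(e)=v}s_es_e^*$ whenever $0<|s^{-1}(v)|<\infty$. The labelled graph $(E_{\mathcal G},\pi_{\mathcal G})$ has vertex set $G^0$ and, for every $e\in\mathcal G^1$ and $w\in r(e)$, one edge from $s(e)$ to $w$ with label $e$. A covering $p:F\to E$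 is a graph morphism, surjective on vertices, that maps $s^{-1}(v)$ and $r^{-1}(v)$ bijectively onto $s^{-1}(p(v))$ and $r^{-1}(p(v))$ for every $v\in F^0$; the induced labelling is $\pi_p=p|_{F^1}:F^1\to E^1$. An out-splitting of $E$ is given by a partition $\mathcal P$ of $s^{-1}(v)$ into $m(v)\ge1$ nonempty cells for each non-sink $v$; put $m(v)=0$ for sinks. The graph $E_s(\mathcal P)$ has vertices $v^i$ ($1\le i\le m(v)$) and $v$ (if $m(v)=0$), and edges $e^j$ ($1\le j\le m(r(e))$) from $s(e)^i$ to $r(e)^j$, or one edge $e$ from $s(e)^i$ to $r(e)$ if $m(r(e))=0$, where $e$ lies in the $i$-th cell of $s^{-1}(s(e))$; the induced labelling is $\pi(e^j)=e$, $\pi(e)=e$. $\mathcal P$ is proper if for every $v$ with $s^{-1}(v)$ infinite, $m(v)<\infty$ and exactly one cell of $s^{-1}(v)$ is infinite. **Proposition.** All labelled spaces below are weakly left-resolving, and the following hold. (i) Let $E$ be a directed graph with the trivial labelling $\pi=\mathrm{id}:E^1\to E^1$. Then $C^*(E,\pi,\mathcal E^0)\cong C^*(E)$. (ii) Let $\mathcal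 G$ be an ultragraph. Then $C^*(E_{\mathcal G},\pi_{\mathcal G},\mathcal E^0_{\mathcal G})\cong C^*(\mathcal G)$. (iii) Let $p:F\to E$ be a covering with induced labelling $\pi_p$. The collection $\mathcal C_p=\{p^{-1}(S):S\subseteq E^0\text{ finite}\}$ is accommodating for $(F,\pi_p)$ and $C^*(F,\pi_p,\mathcal C_p)\cong C^*(E)$. If every source and every sink of $F$ is the only vertex in its fibre of $p$ (for instance, if $F$ has no sources and no sinks), then also $C^*(F,\pi_p,\mathcal F^0)\cong C^*(E)$. (iv) Let $\mathcal P$ be a proper partition of a directed graph $E$ and $\pi$ the induced labelling of the out-split graph $E_s(\mathcal P)$. Then $C^*(E_s(\mathcal P),\pi,\mathcal E_s(\mathcal P)^0)\cong C^*(E)$. -/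

import Mathlib

open scoped ENNReal

universe u

noncomputable section

namespace LabelledGraphAlgebras

/-! ### Universal C*-algebras given by generators and relations -/

/-- A system of relations on a set `G` of generators, to be satisfied in C*-algebras. The relations
force every generator to have norm at most one, so that a universal C*-algebra exists. -/
structure Relations (G : Type u) where
  /-- the family `f` of elements of the C*-algebra `B` satisfies the relations -/
  Holds : ∀ {B : Type u} [NonUnitalCStarAlgebra B], (G → B) → Prop
  norm_le_one : ∀ {B : Type u} [NonUnitalCStarAlgebra B] (f : G → B), Holds f → ∀ g, ‖f g‖ ≤ 1

namespace Relations

variable {G : Type u} (R : Relations G)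

/-- A model of the relations: a C*-algebra with a family of elements that satisfies them. -/
structure Model where
  carrier : Type u
  [cstar : NonUnitalCStarAlgebra carrier]
  gen : G → carrier
  holds : R.Holds gen

attribute [instance] Model.cstar

/-- The bounded product of all models. -/
abbrev Product : Type (u + 1) := lp (fun M : R.Model => M.carrier) ∞

/-- The canonical generators of the product of all models: in each coordinate `M` it is the
generator of the model `M`. -/
def productGen (g : G) : R.Product :=
  ⟨fun M => M.gen g, memℓp_infty ⟨1, by
    rintro _ ⟨M, rfl⟩
    exact R.norm_le_one M.gen M.holds g⟩⟩

/-- The closed *-subalgebra of the product of all models generated by the canonical generators. -/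
def closedSubalgebra : NonUnitalStarSubalgebra ℂ R.Product :=
  (NonUnitalStarAlgebra.adjoin ℂ (Set.range R.productGen)).topologicalClosure

/-- The universal C*-algebra of the relations. (Every C*-algebra generated by a family indexed by
`G : Type u` is isomorphic to one whose underlying type lives in `Type u`, so that the models above
are all the C*-algebras generated by families satisfying the relations, up to isomorphism.) -/
def CStar : Type (u + 1) := R.closedSubalgebra

instance : NonUnitalCStarAlgebra R.CStar :=
  NonUnitalStarSubalgebra.nonUnitalCStarAlgebra R.closedSubalgebra
    (h_closed := NonUnitalStarSubalgebra.isClosed_topologicalClosure _)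

/-- The canonical generators of the universal C*-algebra. -/
def gen (g : G) : R.CStar :=
  ⟨R.productGen g, NonUnitalStarSubalgebra.le_topologicalClosure _
    (NonUnitalStarAlgebra.subset_adjoin ℂ _ ⟨g, rfl⟩)⟩

/-- The universal property: a family satisfying the relations in a C*-algebra `B` is the image of
the canonical generators under a *-homomorphism. -/
theorem exists_lift {B : Type u} [NonUnitalCStarAlgebra B] (f : G → B) (hf : R.Holds f) :
    ∃ φ : R.CStar →⋆ₙₐ[ℂ] B, ∀ g, φ (R.gen g) = f g :=
  ⟨{ toFun := fun x => (x.1 : ∀ M : R.Model, M.carrier) ⟨B, f, hf⟩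
     map_smul' := fun _ _ => rfl
     map_zero' := rfl
     map_add' := fun _ _ => rfl
     map_mul' := fun _ _ => rfl
     map_star' := fun _ => rfl }, fun _ => rfl⟩

end Relations

/-! ### Directed graphs and Cuntz–Krieger families -/

/-- A directed graph with vertex set `V`, edge set `X`, source map `src` and range map `rng`. -/
structure DirectedGraph (V X : Type u) where
  src : X → V
  rng : X → V

namespace DirectedGraph

variable {V X : Type u} (E : DirectedGraph V X)

/-- A sink emits no edge. -/
def IsSink (v : V) : Prop := ∀ e, E.src e ≠ v

/-- A source receives no edge. -/
def IsSource (v : V) : Prop := ∀ e, E.rng e ≠ v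

/-- Cuntz–Krieger `E`-families `{p_v, s_e}` in a C*-algebra. -/
structure IsCuntzKrieger {B : Type u} [NonUnitalCStarAlgebra B] (p : V → B) (s : X → B) :
    Prop where
  proj : ∀ v, IsStarProjection (p v)
  orthogonal : ∀ v w, v ≠ w → p v * p w = 0
  partialIsometry : ∀ e, s e * star (s e) * s e = s e
  star_mul_self : ∀ e, star (s e) * s e = p (E.rng e)
  /-- `s_e s_e* ≤ p_{s(e)}`, as projections -/
  range_le : ∀ e, p (E.src e) * (s e * star (s e)) = s e * star (s e)
  /-- the partial isometries have mutually orthogonal ranges -/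
  range_orthogonal : ∀ e f, e ≠ f → star (s e) * s f = 0
  /-- `p_v = ∑_{s(e) = v} s_e s_e*` whenever `0 < |s⁻¹(v)| < ∞` -/
  sum_eq : ∀ v, ∀ hfin : {e | E.src e = v}.Finite, {e | E.src e = v}.Nonempty →
    p v = ∑ e ∈ hfin.toFinset, s e * star (s e)

end DirectedGraph

theorem norm_le_one_of_star_mul_self {B : Type u} [NonUnitalCStarAlgebra B] {x q : B}
    (hq : IsStarProjection q) (h : star x * x = q) : ‖x‖ ≤ 1 := by
  have h1 : ‖x‖ * ‖x‖ ≤ 1 := by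
    rw [← CStarRing.norm_star_mul_self, h]
    exact hq.norm_le
  nlinarith [norm_nonneg x]

namespace DirectedGraph

variable {V X : Type u} (E : DirectedGraph V X)

/-- The relations of a Cuntz–Krieger `E`-family. -/
def relations : Relations (V ⊕ X) where
  Holds f := E.IsCuntzKrieger (fun v => f (.inl v)) (fun e => f (.inr e))
  norm_le_one f hf g := by
    rcases g with v | e
    · exact (hf.proj v).norm_le
    · exact norm_le_one_of_star_mul_self (hf.proj _) (hf.star_mul_self e)

/-- The graph C*-algebra `C*(E)`. -/
abbrev CStar : Type (u + 1) := E.relations.CStar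

end DirectedGraph

/-! ### Labelled graphs and labelled spaces -/

/-- A labelled graph over the alphabet `A`: a directed graph with a labelling of its edges. -/
structure LabelledGraph (V X A : Type u) extends DirectedGraph V X where
  lab : X → A

namespace LabelledGraph

variable {V X A : Type u} (Γ : LabelledGraph V X A)

/-- `Γ.Path α v w`: the word `α` is represented by a path of length `≥ 1` from `v` to `w`. -/
inductive Path : List A → V → V → Prop
  | single (e : X) : Path [Γ.lab e] (Γ.src e) (Γ.rng e)
  | cons (e : X) {α : List A} {w : V} :
      Path α (Γ.rng e) w → Path (Γ.lab e :: α) (Γ.src e) w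

/-- The labelled paths `ℒ(E,π)`. -/
def language : Set (List A) := {α | ∃ v w, Γ.Path α v w}

/-- `s_π(α)`. -/
def sources (α : List A) : Set V := {v | ∃ w, Γ.Path α v w}

/-- `r_π(α)`. -/
def ranges (α : List A) : Set V := {w | ∃ v, Γ.Path α v w}

/-- The relative range `r(B,α)`. -/
def relRange (B : Set V) (α : List A) : Set V := {w | ∃ v ∈ B, Γ.Path α v w}

/-- A collection of sets of vertices is accommodating if it is closed under relative ranges,
contains all `r(α)`, and is closed under finite unions (the empty one included) and
intersections. -/
structure Accommodating (C : Set (Set V)) : Prop where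
  empty_mem : ∅ ∈ C
  inter_mem : ∀ B ∈ C, ∀ D ∈ C, B ∩ D ∈ C
  union_mem : ∀ B ∈ C, ∀ D ∈ C, B ∪ D ∈ C
  ranges_mem : ∀ α ∈ Γ.language, Γ.ranges α ∈ C
  relRange_mem : ∀ B ∈ C, ∀ α ∈ Γ.language, Γ.relRange B α ∈ C

/-- The collection `ℰ`: the singletons of sources and sinks, all `r(α)` and all `s(α)`. -/
def basicSets : Set (Set V) :=
  {B | ∃ v, (Γ.IsSource v ∨ Γ.IsSink v) ∧ B = {v}} ∪
    {B | ∃ α ∈ Γ.language, B = Γ.ranges α} ∪ {B | ∃ α ∈ Γ.language, B = Γ.sources α}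

/-- `L¹_B`: the labels `a ∈ ℒ¹(E,π)` with `B ∩ s(a) ≠ ∅`. -/
def labelsFrom (B : Set V) : Set (Set.range Γ.lab) :=
  {a | (B ∩ Γ.sources [a.1]).Nonempty}

theorem single_mem_language (a : Set.range Γ.lab) : [a.1] ∈ Γ.language := by
  obtain ⟨_, e, rfl⟩ := a
  exact ⟨_, _, .single e⟩

end LabelledGraph

/-- A labelled space `(E,π,C)`: a labelled graph with an accommodating collection `C`. -/
structure LabelledSpace {V X A : Type u} (Γ : LabelledGraph V X A) where
  sets : Set (Set V)
  accommodating : Γ.Accommodating sets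

namespace LabelledSpace

variable {V X A : Type u} {Γ : LabelledGraph V X A} (L : LabelledSpace Γ)

/-- Weakly left-resolving labelled spaces. -/
def WeaklyLeftResolving : Prop :=
  ∀ B ∈ L.sets, ∀ D ∈ L.sets, ∀ α ∈ Γ.language,
    Γ.relRange B α ∩ Γ.relRange D α = Γ.relRange (B ∩ D) α

/-- The empty set, as a member of `C`. -/
def empty : L.sets := ⟨∅, L.accommodating.empty_mem⟩

/-- Intersections in `C`. -/
def inter (B D : L.sets) : L.sets := ⟨B.1 ∩ D.1, L.accommodating.inter_mem _ B.2 _ D.2⟩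

/-- Unions in `C`. -/
def union (B D : L.sets) : L.sets := ⟨B.1 ∪ D.1, L.accommodating.union_mem _ B.2 _ D.2⟩

/-- `r(a)`, as a member of `C`. -/
def range (a : Set.range Γ.lab) : L.sets :=
  ⟨Γ.ranges [a.1], L.accommodating.ranges_mem _ (Γ.single_mem_language a)⟩

/-- `r(B,a)`, as a member of `C`. -/
def relRange (B : L.sets) (a : Set.range Γ.lab) : L.sets :=
  ⟨Γ.relRange B.1 [a.1], L.accommodating.relRange_mem _ B.2 _ (Γ.single_mem_language a)⟩

/-- Representations `{p_B, s_a : B ∈ C, a ∈ ℒ¹(E,π)}` of a labelled space in a C*-algebra. -/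
structure IsRepresentation {B : Type u} [NonUnitalCStarAlgebra B]
    (p : L.sets → B) (s : Set.range Γ.lab → B) : Prop where
  proj : ∀ D, IsStarProjection (p D)
  partialIsometry : ∀ a, s a * star (s a) * s a = s a
  map_empty : p L.empty = 0
  map_inter : ∀ D D', p D * p D' = p (L.inter D D')
  map_union : ∀ D D', p (L.union D D') = p D + p D' - p (L.inter D D')
  proj_mul : ∀ D a, p D * s a = s a * p (L.relRange D a)
  star_mul_self : ∀ a, star (s a) * s a = p (L.range a)
  range_orthogonal : ∀ a b, a ≠ b → star (s a) * s b = 0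
  /-- `p_D = ∑_{a ∈ L¹_D} s_a p_{r(D,a)} s_a*` if `L¹_D` is finite and nonempty and `D` contains
  no sink; on graphs without sinks the last proviso is void. (A sink in `D` emits no label, so it
  is not seen by the sum; without the proviso the relation would kill the projections of sinks.) -/
  sum_eq : ∀ D : L.sets, (∀ v ∈ D.1, ¬ Γ.IsSink v) →
    ∀ hfin : (Γ.labelsFrom D.1).Finite, (Γ.labelsFrom D.1).Nonempty →
      p D = ∑ a ∈ hfin.toFinset, s a * p (L.relRange D a) * star (s a)

/-- The relations of a representation of a labelled space. -/
def relations : Relations (L.sets ⊕ Set.range Γ.lab) where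
  Holds f := L.IsRepresentation (fun D => f (.inl D)) (fun a => f (.inr a))
  norm_le_one f hf g := by
    rcases g with D | a
    · exact (hf.proj D).norm_le
    · exact norm_le_one_of_star_mul_self (hf.proj _) (hf.star_mul_self a)

/-- The C*-algebra `C*(E,π,C)` of a labelled space. -/
abbrev CStar : Type (u + 1) := L.relations.CStar

end LabelledSpace

/-- The labelled space `(E,π,ℰ⁰)`, where `ℰ⁰` is the smallest accommodating collection
containing `ℰ`. -/
def LabelledGraph.space {V X A : Type u} (Γ : LabelledGraph V X A) : LabelledSpace Γ where
  sets := {B | ∀ C : Set (Set V), Γ.Accommodating C → Γ.basicSets ⊆ C → B ∈ C}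
  accommodating :=
    { empty_mem := fun _ h _ => h.empty_mem
      inter_mem := fun _ hB _ hD C h h' => h.inter_mem _ (hB C h h') _ (hD C h h')
      union_mem := fun _ hB _ hD C h h' => h.union_mem _ (hB C h h') _ (hD C h h')
      ranges_mem := fun α hα _ h _ => h.ranges_mem α hα
      relRange_mem := fun _ hB α hα C h h' => h.relRange_mem _ (hB C h h') α hα }

/-! ### The trivial labelling -/

/-- The directed graph `E` with the trivial labelling. -/
def DirectedGraph.trivialLabelling {V X : Type u} (E : DirectedGraph V X) :
    LabelledGraph V X X where
  toDirectedGraph := E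
  lab := id

/-! ### Ultragraphs -/

/-- An ultragraph with vertex set `V` and edge set `X`; ranges of edges are nonempty sets of
vertices. -/
structure Ultragraph (V X : Type u) where
  src : X → V
  rng : X → Set V
  rng_nonempty : ∀ e, (rng e).Nonempty

namespace Ultragraph

variable {V X : Type u} (𝒢 : Ultragraph V X)

/-- `𝒢⁰`: the smallest collection of sets of vertices that contains all `{v}` and all `r(e)` and
is closed under finite unions and intersections. -/
inductive Sets : Set V → Prop
  | empty : Sets ∅
  | singleton (v : V) : Sets {v}
  | rng (e : X) : Sets (𝒢.rng e)
  | inter {B D : Set V} : Sets B → Sets D → Sets (B ∩ D)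
  | union {B D : Set V} : Sets B → Sets D → Sets (B ∪ D)

/-- The members of `𝒢⁰`. -/
abbrev Members : Type u := {B : Set V // 𝒢.Sets B}

/-- Cuntz–Krieger `𝒢`-families in a C*-algebra. -/
structure IsCuntzKrieger {B : Type u} [NonUnitalCStarAlgebra B]
    (p : 𝒢.Members → B) (s : X → B) : Prop where
  proj : ∀ D, IsStarProjection (p D)
  partialIsometry : ∀ e, s e * star (s e) * s e = s e
  range_orthogonal : ∀ e f, e ≠ f → star (s e) * s f = 0
  map_empty : p ⟨∅, .empty⟩ = 0
  map_inter : ∀ D D' : 𝒢.Members, p D * p D' = p ⟨D.1 ∩ D'.1, .inter D.2 D'.2⟩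
  map_union : ∀ D D' : 𝒢.Members, p ⟨D.1 ∪ D'.1, .union D.2 D'.2⟩ =
    p D + p D' - p ⟨D.1 ∩ D'.1, .inter D.2 D'.2⟩
  star_mul_self : ∀ e, star (s e) * s e = p ⟨𝒢.rng e, .rng e⟩
  /-- `s_e s_e* ≤ p_{s(e)}`, as projections -/
  range_le : ∀ e, p ⟨{𝒢.src e}, .singleton _⟩ * (s e * star (s e)) = s e * star (s e)
  /-- `p_v = ∑_{s(e) = v} s_e s_e*` whenever `0 < |s⁻¹(v)| < ∞` -/
  sum_eq : ∀ v, ∀ hfin : {e | 𝒢.src e = v}.Finite, {e | 𝒢.src e = v}.Nonempty →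
    p ⟨{v}, .singleton v⟩ = ∑ e ∈ hfin.toFinset, s e * star (s e)

/-- The relations of a Cuntz–Krieger `𝒢`-family. -/
def relations : Relations (𝒢.Members ⊕ X) where
  Holds f := 𝒢.IsCuntzKrieger (fun D => f (.inl D)) (fun e => f (.inr e))
  norm_le_one f hf g := by
    rcases g with D | e
    · exact (hf.proj D).norm_le
    · exact norm_le_one_of_star_mul_self (hf.proj _) (hf.star_mul_self e)

/-- The ultragraph algebra `C*(𝒢)`. -/
abbrev CStar : Type (u + 1) := 𝒢.relations.CStar

/-- The labelled graph of an ultragraph: there is one edge for each pair of an edge `e` of the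
ultragraph and a vertex `w ∈ r(e)`; it goes from `s(e)` to `w` and has the label `e`. -/
def labelledGraph : LabelledGraph V {x : X × V // x.2 ∈ 𝒢.rng x.1} X where
  src x := 𝒢.src x.1.1
  rng x := x.1.2
  lab x := x.1.1

end Ultragraph

/-! ### Coverings -/

/-- A covering of directed graphs `F → E`: a graph morphism, surjective on vertices, that maps
`s⁻¹(v)` and `r⁻¹(v)` bijectively onto `s⁻¹(p(v))` and `r⁻¹(p(v))`, for every vertex `v` of `F`.
(Surjectivity on edges follows.) -/
structure IsCovering {V X W Y : Type u} (F : DirectedGraph W Y) (E : DirectedGraph V X)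
    (p₀ : W → V) (p₁ : Y → X) : Prop where
  map_src : ∀ f, E.src (p₁ f) = p₀ (F.src f)
  map_rng : ∀ f, E.rng (p₁ f) = p₀ (F.rng f)
  surjective : Function.Surjective p₀
  bijOn_src : ∀ v, Set.BijOn p₁ {f | F.src f = v} {e | E.src e = p₀ v}
  bijOn_rng : ∀ v, Set.BijOn p₁ {f | F.rng f = v} {e | E.rng e = p₀ v}

/-- The labelling of `F` by the edges of `E` induced by a map `p₁ : F¹ → E¹`. -/
def DirectedGraph.labelBy {W Y X : Type u} (F : DirectedGraph W Y) (p₁ : Y → X) :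
    LabelledGraph W Y X where
  toDirectedGraph := F
  lab := p₁

namespace IsCovering

variable {V X W Y : Type u} {F : DirectedGraph W Y} {E : DirectedGraph V X}
  {p₀ : W → V} {p₁ : Y → X}

theorem path_map (h : IsCovering F E p₀ p₁) {α : List X} {v w : W}
    (hα : (F.labelBy p₁).Path α v w) : E.trivialLabelling.Path α (p₀ v) (p₀ w) := by
  induction hα with
  | single e =>
    have := LabelledGraph.Path.single (Γ := E.trivialLabelling) (p₁ e)
    change E.trivialLabelling.Path [p₁ e] (E.src (p₁ e)) (E.rng (p₁ e)) at this
    rwa [h.map_src, h.map_rng] at this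
  | @cons e α w _ ih =>
    have ih' : E.trivialLabelling.Path α (E.rng (p₁ e)) (p₀ w) := by
      rw [h.map_rng]; exact ih
    have := LabelledGraph.Path.cons (Γ := E.trivialLabelling) (p₁ e) ih'
    change E.trivialLabelling.Path (p₁ e :: α) (E.src (p₁ e)) (p₀ w) at this
    rwa [h.map_src] at this

theorem path_lift (h : IsCovering F E p₀ p₁) {α : List X} {x y : V}
    (hα : E.trivialLabelling.Path α x y) :
    ∀ w, p₀ w = y → ∃ v, p₀ v = x ∧ (F.labelBy p₁).Path α v w := by
  induction hα with
  | single e =>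
    intro w hw
    obtain ⟨f, hf, rfl⟩ := (h.bijOn_rng w).surjOn (show e ∈ {e | E.rng e = p₀ w} from hw.symm)
    exact ⟨F.src f, (h.map_src f).symm, by
      have := LabelledGraph.Path.single (Γ := F.labelBy p₁) f
      have hf' : (F.labelBy p₁).rng f = w := hf
      rwa [hf'] at this⟩
  | @cons e α y _ ih =>
    intro w hw
    obtain ⟨u, hu, hp⟩ := ih w hw
    obtain ⟨f, hf, rfl⟩ := (h.bijOn_rng u).surjOn (show e ∈ {e | E.rng e = p₀ u} from hu.symm)
    have hf' : F.rng f = u := hf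
    subst hf'
    exact ⟨F.src f, (h.map_src f).symm, LabelledGraph.Path.cons (Γ := F.labelBy p₁) f hp⟩

theorem relRange_preimage (h : IsCovering F E p₀ p₁) (S : Set V) (α : List X) :
    (F.labelBy p₁).relRange (p₀ ⁻¹' S) α = p₀ ⁻¹' (E.trivialLabelling.relRange S α) := by
  ext w
  constructor
  · rintro ⟨v, hv, hp⟩
    exact ⟨p₀ v, hv, h.path_map hp⟩
  · rintro ⟨x, hx, hp⟩
    obtain ⟨v, rfl, hv⟩ := h.path_lift hp w rfl
    exact ⟨v, hx, hv⟩

end IsCovering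

theorem DirectedGraph.path_end_unique {V X : Type u} (E : DirectedGraph V X) {α : List X}
    {x y : V} (h : E.trivialLabelling.Path α x y) :
    ∀ x' y', E.trivialLabelling.Path α x' y' → y = y' := by
  induction h with
  | single e =>
    intro x' y' h'
    cases h' with
    | single _ => rfl
    | cons _ h'' => cases h''
  | @cons e α y h ih =>
    intro x' y' h'
    cases h' with
    | single _ => cases h
    | cons _ h'' => exact ih _ _ h''

theorem DirectedGraph.finite_relRange {V X : Type u} (E : DirectedGraph V X) (S : Set V)
    (α : List X) : (E.trivialLabelling.relRange S α).Finite := by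
  apply Set.Subsingleton.finite
  rintro y ⟨x, _, h⟩ y' ⟨x', _, h'⟩
  exact E.path_end_unique h x' y' h'

/-- For a covering `p : F → E`, the labelled space whose collection consists of the inverse images
of the finite sets of vertices of `E`. -/
def IsCovering.fibreSpace {V X W Y : Type u} {F : DirectedGraph W Y} {E : DirectedGraph V X}
    {p₀ : W → V} {p₁ : Y → X} (h : IsCovering F E p₀ p₁) : LabelledSpace (F.labelBy p₁) where
  sets := {B | ∃ S : Set V, S.Finite ∧ B = p₀ ⁻¹' S}
  accommodating :=
    { empty_mem := ⟨∅, Set.finite_empty, rfl⟩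
      inter_mem := by
        rintro _ ⟨S, hS, rfl⟩ _ ⟨T, _, rfl⟩
        exact ⟨S ∩ T, hS.inter_of_left T, rfl⟩
      union_mem := by
        rintro _ ⟨S, hS, rfl⟩ _ ⟨T, hT, rfl⟩
        exact ⟨S ∪ T, hS.union hT, rfl⟩
      ranges_mem := fun α _ => ⟨E.trivialLabelling.relRange Set.univ α, E.finite_relRange _ α, by
        rw [← h.relRange_preimage]
        simp [LabelledGraph.ranges, LabelledGraph.relRange]⟩
      relRange_mem := by
        rintro _ ⟨S, _, rfl⟩ α _
        exact ⟨_, E.finite_relRange S α, h.relRange_preimage S α⟩ }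

/-! ### Out-splittings -/

/-- A partition of the sets `s⁻¹(v)`, for the vertices `v` of `E` that are not sinks, into nonempty
subsets, given as an equivalence relation on the edges of `E` that identifies only edges with the
same source. -/
structure OutPartition {V X : Type u} (E : DirectedGraph V X) where
  toSetoid : Setoid X
  src_eq : ∀ e f, toSetoid.r e f → E.src e = E.src f

namespace OutPartition

variable {V X : Type u} {E : DirectedGraph V X} (P : OutPartition E)

/-- The cells of the partition. -/
abbrev Cell : Type u := Quotient P.toSetoid

/-- The cell of an edge. -/
def cell (e : X) : P.Cell := Quotient.mk P.toSetoid e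

/-- The vertex whose emitted edges are partitioned by the given cell. -/
def cellSrc : P.Cell → V := Quotient.lift E.src P.src_eq

/-- The vertices of the out-split graph: `v¹, …, v^{m(v)}`, one for each cell of `s⁻¹(v)`, if `v`
is not a sink, and `v` itself if `v` is a sink. -/
abbrev Vertex : Type u := P.Cell ⊕ {v : V // E.IsSink v}

/-- The vertex of `E` from which a vertex of the out-split graph arises. -/
def base : P.Vertex → V := Sum.elim P.cellSrc Subtype.val

/-- The out-split graph `E_s(P)`, labelled by the edges of `E`. Its edges with label `e` correspond
to the vertices `x` arising from `r(e)`: they are the `e^j` from `s(e)^i` to `r(e)^j`, where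
`e` belongs to the `i`-th cell of `s⁻¹(s(e))`, if `r(e)` is not a sink, and one edge from `s(e)^i`
to `r(e)` if `r(e)` is a sink. -/
def outSplit : LabelledGraph P.Vertex {x : X × P.Vertex // P.base x.2 = E.rng x.1} X where
  src x := .inl (P.cell x.1.1)
  rng x := x.1.2
  lab x := x.1.1

/-- The partition is proper if for every vertex `v` that emits infinitely many edges the number
`m(v)` of cells of `s⁻¹(v)` is finite and exactly one of these cells is infinite. -/
def Proper : Prop :=
  ∀ v, {e | E.src e = v}.Infinite →
    {c | P.cellSrc c = v}.Finite ∧ ∃! c, P.cellSrc c = v ∧ {e | P.cell e = c}.Infinite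

end OutPartition

end LabelledGraphAlgebras

end

/-! All four statements reduce to ultragraph algebras, in two steps.

Collapsing labelled graphs: suppose that the edges with label `a` all start in one fibre of a vertex
map `q : W → U` and that they reach exactly the fibres over a set `r(a)`, as in `LiesOver`. Then
`r(q⁻¹S, a)` is `q⁻¹(r(a))` or `∅`, according to whether `s(a) ∈ S`. If the accommodating collection
consists of the sets `q⁻¹S` with `S ∈ 𝒢⁰`, a representation of the labelled space is the same thing
as a Cuntz–Krieger `𝒢`-family (`LiesOver.nonempty_equiv`). Weak left-resolvability holds because the
first letter of a word fixes the fibre in which its paths start. For `ℰ⁰` the collection has this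
form as soon as sources and sinks are alone in their fibres (`space_sets`).

Splitting vertices: let the vertices of `E` be split into those of an ultragraph `𝒢` with the same
edges, so that over each `v` all vertices but one, `d v`, emit finitely many edges, and at least
one. In an `E`-family the projection of such a vertex must be the finite sum of its `s_e s_e*`, and
that of `d v` is what remains of `p_v`. Conversely `p_v` is the projection of the fibre over `v`.
These constructions are mutually inverse (`Splits.nonempty_equiv`).

Trivial labellings and coverings lie over `E` itself, viewed as an ultragraph and split trivially.
Ultragraphs need only the first step. An out-split graph lies over an ultragraph on its own
vertices, and properness of the partition says that this ultragraph splits `E`. -/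

noncomputable section

namespace LabelledGraphAlgebras

/-! ### Isomorphisms between universal C*-algebras. -/

namespace Relations

variable {G G' : Type u} (R : Relations G) (R' : Relations G')

/-- The *-homomorphism from the universal C*-algebra to a model. -/
def eval (M : R.Model) : R.CStar →⋆ₙₐ[ℂ] M.carrier where
  toFun x := (x.1 : ∀ M : R.Model, M.carrier) M
  map_smul' _ _ := rfl
  map_zero' := rfl
  map_add' _ _ := rfl
  map_mul' _ _ := rfl
  map_star' _ := rfl

theorem eval_gen (M : R.Model) (g : G) : R.eval M (R.gen g) = M.gen g := rfl

/-- A translation of relations: a way to turn families satisfying `R'` into families, in the same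
C*-algebra, that satisfy `R`, given by elements of the universal C*-algebra of `R'`. -/
structure Translation where
  map : ∀ {B : Type u} [NonUnitalCStarAlgebra B], (G' → B) → G → B
  holds : ∀ {B : Type u} [NonUnitalCStarAlgebra B] (f : G' → B), R'.Holds f → R.Holds (map f)
  term : G → R'.CStar
  eval_term : ∀ (M : R'.Model) (g : G), R'.eval M (term g) = map M.gen g

namespace Translation

variable {R R'} (T : Translation R R') (T' : Translation R' R)

/-- The translation of a model. -/
abbrev model (M : R'.Model) : R.Model := ⟨M.carrier, T.map M.gen, T.holds _ M.holds⟩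

/-- The *-homomorphism induced by a translation on the products of all models. -/
def productHom : R.Product →⋆ₙₐ[ℂ] R'.Product where
  toFun x := ⟨fun M => x (T.model M), memℓp_infty ⟨‖x‖, by
    rintro _ ⟨M, rfl⟩
    exact lp.norm_apply_le_norm (by simp) x (T.model M)⟩⟩
  map_smul' _ _ := rfl
  map_zero' := rfl
  map_add' _ _ := rfl
  map_mul' _ _ := rfl
  map_star' _ := rfl

theorem continuous_productHom : Continuous T.productHom :=
  AddMonoidHomClass.continuous_of_bound T.productHom 1 fun x => by
    rw [one_mul]
    exact lp.norm_le_of_forall_le (norm_nonneg x) fun M =>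
      lp.norm_apply_le_norm (by simp) x (T.model M)

/-- The image of a generator agrees with `T.term g` in every coordinate, so it lies in the target
subalgebra. The preimage of that subalgebra is a closed *-subalgebra, hence contains the closure of
what the generators generate. -/
theorem productHom_mem {x : R.Product} (hx : x ∈ R.closedSubalgebra) :
    T.productHom x ∈ R'.closedSubalgebra := by
  have hle : NonUnitalStarAlgebra.adjoin ℂ (Set.range R.productGen) ≤
      R'.closedSubalgebra.comap T.productHom := by
    refine NonUnitalStarAlgebra.adjoin_le ?_
    rintro _ ⟨g, rfl⟩
    change T.productHom (R.productGen g) ∈ R'.closedSubalgebra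
    have : T.productHom (R.productGen g) = (T.term g).1 := by
      ext M
      exact (T.eval_term M g).symm
    rw [this]
    exact (T.term g).2
  have hcl : IsClosed ((R'.closedSubalgebra.comap T.productHom : Set R.Product)) :=
    (NonUnitalStarSubalgebra.isClosed_topologicalClosure _).preimage T.continuous_productHom
  exact NonUnitalStarSubalgebra.topologicalClosure_minimal _ hle hcl hx

/-- The *-homomorphism of universal C*-algebras induced by a translation of relations. -/
def hom : R.CStar →⋆ₙₐ[ℂ] R'.CStar where
  toFun x := ⟨T.productHom x.1, T.productHom_mem x.2⟩
  map_smul' _ _ := rfl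
  map_zero' := rfl
  map_add' _ _ := rfl
  map_mul' _ _ := rfl
  map_star' _ := rfl

theorem hom_hom (h : ∀ M : R.Model, T.map (T'.map M.gen) = M.gen) (x : R.CStar) :
    T'.hom (T.hom x) = x := by
  -- The doubly translated model has the carrier of `M` and a family only provably equal to `M.gen`.
  -- Stating the claim for a variable family allows that equality to be substituted.
  have key : ∀ (M : R.Model) (f : G → M.carrier) (hf : R.Holds f), f = M.gen →
      (x.1 : ∀ M : R.Model, M.carrier) ⟨M.carrier, f, hf⟩ =
        (x.1 : ∀ M : R.Model, M.carrier) M := by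
    rintro M _ _ rfl
    rfl
  apply Subtype.ext
  ext M
  exact key M _ _ (h M)

/-- Mutually inverse translations of relations induce an isomorphism of the universal
C*-algebras. -/
def equiv (h : ∀ M : R.Model, T.map (T'.map M.gen) = M.gen)
    (h' : ∀ M : R'.Model, T'.map (T.map M.gen) = M.gen) : R.CStar ≃⋆ₐ[ℂ] R'.CStar where
  toFun := T.hom
  invFun := T'.hom
  left_inv := T.hom_hom T' h
  right_inv := T'.hom_hom T h'
  map_mul' := map_mul T.hom
  map_add' := map_add T.hom
  map_smul' := map_smul T.hom
  map_star' := map_star T.hom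

end Translation

/-- Relations that differ by a renaming of the generators have isomorphic universal
C*-algebras. -/
theorem nonempty_equiv_of_reindex {R : Relations G} {R' : Relations G'} (θ : G ≃ G')
    (h : ∀ {B : Type u} [NonUnitalCStarAlgebra B] (f : G' → B),
      R'.Holds f ↔ R.Holds (f ∘ θ)) : Nonempty (R.CStar ≃⋆ₐ[ℂ] R'.CStar) := by
  let T : Translation R R' :=
    { map := fun f => f ∘ θ
      holds := fun f hf => (h f).1 hf
      term := fun g => R'.gen (θ g)
      eval_term := fun _ _ => rfl }
  let T' : Translation R' R :=
    { map := fun f => f ∘ θ.symm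
      holds := fun f hf => (h _).2 (by simpa [Function.comp_assoc] using hf)
      term := fun g => R.gen (θ.symm g)
      eval_term := fun _ _ => rfl }
  exact ⟨T.equiv T' (fun M => by funext g; simp [T, T']) (fun M => by funext g; simp [T, T'])⟩

end Relations

/-! ### Vertex sets of ultragraphs and Cuntz–Krieger families. -/

namespace Ultragraph

variable {V X : Type u} {𝒢 : Ultragraph V X}

theorem sets_of_finite {S : Set V} (hS : S.Finite) : 𝒢.Sets S := by
  induction S, hS using Set.Finite.induction_on with
  | empty => exact .empty
  | @insert a s _ _ ih =>
    rw [Set.insert_eq]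
    exact .union (.singleton a) ih

theorem finite_of_sets (h : ∀ e, (𝒢.rng e).Finite) {S : Set V} (hS : 𝒢.Sets S) : S.Finite := by
  induction hS with
  | empty => exact Set.finite_empty
  | singleton v => exact Set.finite_singleton v
  | rng e => exact h e
  | inter _ _ ih _ => exact ih.inter_of_left _
  | union _ _ ih ih' => exact ih.union ih'

namespace IsCuntzKrieger

variable {B : Type u} [NonUnitalCStarAlgebra B] {p : 𝒢.Members → B} {s : X → B}

theorem vertex_sum (h : 𝒢.IsCuntzKrieger p s) (S : Finset V) (hS : 𝒢.Sets (S : Set V)) :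
    p ⟨S, hS⟩ = ∑ v ∈ S, p ⟨{v}, .singleton v⟩ := by
  classical
  induction S using Finset.induction_on with
  | empty =>
    rw [Finset.sum_empty, ← h.map_empty]
    congr 2
    simp
  | @insert a S ha ih =>
    have hS' : 𝒢.Sets (S : Set V) := sets_of_finite S.finite_toSet
    rw [Finset.sum_insert ha, ← ih hS']
    have hu := h.map_union ⟨{a}, .singleton a⟩ ⟨S, hS'⟩
    have h0 : p ⟨{a} ∩ (S : Set V), .inter (.singleton a) hS'⟩ = 0 := by
      rw [← h.map_empty]
      congr 2
      simpa using ha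
    rw [h0, sub_zero] at hu
    rw [← hu]
    congr 2
    rw [Finset.coe_insert, Set.insert_eq]

theorem singleton_mul (h : 𝒢.IsCuntzKrieger p s) (e : X) :
    p ⟨{𝒢.src e}, .singleton _⟩ * s e = s e := by
  conv_lhs => rw [← h.partialIsometry e, ← mul_assoc, h.range_le]
  exact h.partialIsometry e

-- Since `s_e = p_{s(e)} s_e`, the product is `p_{D ∩ {s(e)}} s_e`, and the intersection is `{s(e)}`
-- or empty.
open Classical in
theorem proj_mul (h : 𝒢.IsCuntzKrieger p s) (D : 𝒢.Members) (e : X) :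
    p D * s e = if 𝒢.src e ∈ D.1 then s e else 0 := by
  rw [← h.singleton_mul e, ← mul_assoc, h.map_inter]
  split_ifs with hD
  · congr 3
    simpa using hD
  · have : p ⟨D.1 ∩ {𝒢.src e}, .inter D.2 (.singleton _)⟩ = 0 := by
      rw [← h.map_empty]
      congr 2
      simpa using hD
    rw [this, zero_mul]

theorem mul_range (h : 𝒢.IsCuntzKrieger p s) (e : X) :
    s e * p ⟨𝒢.rng e, .rng e⟩ = s e := by
  rw [← h.star_mul_self, ← mul_assoc, h.partialIsometry]

end IsCuntzKrieger

end Ultragraph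

/-! ### Labelled graphs over ultragraphs. -/

namespace LabelledGraph

variable {W Y U X : Type u} {Γ : LabelledGraph W Y X}

theorem path_single_iff {a : X} {v w : W} :
    Γ.Path [a] v w ↔ ∃ f, Γ.lab f = a ∧ Γ.src f = v ∧ Γ.rng f = w := by
  constructor
  · intro h
    cases h with
    | single e => exact ⟨e, rfl, rfl, rfl⟩
    | cons _ h => cases h
  · rintro ⟨f, rfl, rfl, rfl⟩
    exact .single f

/-- A labelled graph lies over an ultragraph, with edge set the alphabet, by a map of vertices if
the edges labelled `a` emanate from the fibre over `s(a)` and end in the fibres over `r(a)`,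
every vertex of the latter is reached, and every vertex in the former emits an edge labelled `a`
into each of these fibres. -/
structure LiesOver (Γ : LabelledGraph W Y X) (𝒢 : Ultragraph U X) (q : W → U) : Prop where
  surjective : Function.Surjective q
  map_src : ∀ f, q (Γ.src f) = 𝒢.src (Γ.lab f)
  mem_rng_iff : ∀ a w, q w ∈ 𝒢.rng a ↔ ∃ f, Γ.lab f = a ∧ Γ.rng f = w
  lift : ∀ w a u, 𝒢.src a = q w → u ∈ 𝒢.rng a →
    ∃ f, Γ.src f = w ∧ Γ.lab f = a ∧ q (Γ.rng f) = u

namespace LiesOver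

variable {𝒢 : Ultragraph U X} {q : W → U} (h : Γ.LiesOver 𝒢 q)
include h

theorem lab_surjective : Function.Surjective Γ.lab := fun a => by
  obtain ⟨u, hu⟩ := 𝒢.rng_nonempty a
  obtain ⟨w, rfl⟩ := h.surjective u
  obtain ⟨f, hf, _⟩ := (h.mem_rng_iff a w).1 hu
  exact ⟨f, hf⟩

theorem map_src_of_path {a : X} {α : List X} {v w : W} (hp : Γ.Path (a :: α) v w) :
    q v = 𝒢.src a := by
  cases hp with
  | single e => exact h.map_src e
  | cons e _ => exact h.map_src e

theorem relRange_single (S : Set U) (a : X) :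
    Γ.relRange (q ⁻¹' S) [a] = {w | 𝒢.src a ∈ S ∧ q w ∈ 𝒢.rng a} := by
  ext w
  simp only [relRange, path_single_iff, Set.mem_preimage, Set.mem_ofPred_eq, h.mem_rng_iff]
  constructor
  · rintro ⟨v, hv, f, rfl, rfl, rfl⟩
    exact ⟨h.map_src f ▸ hv, f, rfl, rfl⟩
  · rintro ⟨hS, f, rfl, rfl⟩
    exact ⟨_, (h.map_src f).symm ▸ hS, f, rfl, rfl, rfl⟩

theorem relRange_single_of_mem {S : Set U} {a : X} (ha : 𝒢.src a ∈ S) :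
    Γ.relRange (q ⁻¹' S) [a] = q ⁻¹' 𝒢.rng a := by
  rw [h.relRange_single]
  ext w
  simp [ha]

theorem relRange_single_of_notMem {S : Set U} {a : X} (ha : 𝒢.src a ∉ S) :
    Γ.relRange (q ⁻¹' S) [a] = ∅ := by
  rw [h.relRange_single]
  ext w
  simp [ha]

theorem ranges_single (a : X) : Γ.ranges [a] = q ⁻¹' 𝒢.rng a := by
  rw [← h.relRange_single_of_mem (Set.mem_univ (𝒢.src a))]
  simp [ranges, relRange]

/-- By the lifting property a path can be redrawn, letter by letter, from any other vertex in the
fibre of its start, with its end staying in the same fibre. Hence `s(aα)` contains the whole fibre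
over `s(a)` once it is nonempty. -/
theorem sources_eq {a : X} {α : List X} (hα : a :: α ∈ Γ.language) :
    Γ.sources (a :: α) = q ⁻¹' {𝒢.src a} := by
  have key : ∀ {β v w}, Γ.Path β v w → ∀ v', q v' = q v → ∃ w', Γ.Path β v' w' ∧ q w' = q w := by
    intro β v w hp
    induction hp with
    | single e =>
      intro v' hv'
      obtain ⟨f, rfl, hf, hr⟩ := h.lift v' (Γ.lab e) (q (Γ.rng e)) (by rw [hv', h.map_src])
        ((h.mem_rng_iff _ _).2 ⟨e, rfl, rfl⟩)
      exact ⟨_, hf ▸ .single f, hr⟩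
    | @cons e β w _ ih =>
      intro v' hv'
      obtain ⟨f, rfl, hf, hr⟩ := h.lift v' (Γ.lab e) (q (Γ.rng e)) (by rw [hv', h.map_src])
        ((h.mem_rng_iff _ _).2 ⟨e, rfl, rfl⟩)
      obtain ⟨w', hp, hw'⟩ := ih _ hr
      exact ⟨w', hf ▸ .cons f hp, hw'⟩
  ext v
  constructor
  · rintro ⟨w, hp⟩
    exact h.map_src_of_path hp
  · intro hv
    obtain ⟨v', w, hp⟩ := hα
    obtain ⟨w', hp', _⟩ := key hp v (Eq.trans hv (h.map_src_of_path hp).symm)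
    exact ⟨w', hp'⟩

theorem isSink_iff (w : W) : Γ.IsSink w ↔ ∀ a, 𝒢.src a ≠ q w := by
  constructor
  · intro hw a ha
    obtain ⟨u, hu⟩ := 𝒢.rng_nonempty a
    obtain ⟨f, hf, _⟩ := h.lift w a u ha hu
    exact hw f hf
  · rintro hw f rfl
    exact hw _ (h.map_src f).symm

theorem mem_labelsFrom_iff (S : Set U) (a : Set.range Γ.lab) :
    a ∈ Γ.labelsFrom (q ⁻¹' S) ↔ 𝒢.src a.1 ∈ S := by
  rw [labelsFrom, Set.mem_ofPred_eq, h.sources_eq (Γ.single_mem_language a)]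
  constructor
  · rintro ⟨w, hw, hw'⟩
    exact (show q w = _ from hw') ▸ hw
  · intro hS
    obtain ⟨w, hw⟩ := h.surjective (𝒢.src a.1)
    exact ⟨w, by simpa [hw] using hS, hw⟩

/-- Two paths with the same word start in the same fibre, so the start of one lies in every preimage
`q⁻¹T` that contains the start of the other. -/
theorem weaklyLeftResolving (L : LabelledSpace Γ)
    (hL : L.sets = {D | ∃ S, 𝒢.Sets S ∧ D = q ⁻¹' S}) : L.WeaklyLeftResolving := by
  intro B hB D hD α _
  rw [hL] at hB hD
  obtain ⟨S, -, rfl⟩ := hB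
  obtain ⟨T, -, rfl⟩ := hD
  ext w
  constructor
  · rintro ⟨⟨v, hv, hp⟩, ⟨v', hv', hp'⟩⟩
    refine ⟨v, ⟨hv, ?_⟩, hp⟩
    cases α with
    | nil => cases hp
    | cons a α =>
      rw [Set.mem_preimage, h.map_src_of_path hp, ← h.map_src_of_path hp']
      exact hv'
  · rintro ⟨v, hv, hp⟩
    exact ⟨⟨v, hv.1, hp⟩, ⟨v, hv.2, hp⟩⟩

/-- Induction on the word, by `r(B, aα) = r(r(B, a), α)`; for a single letter the relative range is
`q⁻¹(r(a))` or empty. -/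
theorem relRange_mem_preimages (S : Set U) {α : List X} (hα : α ≠ []) :
    ∃ T, 𝒢.Sets T ∧ Γ.relRange (q ⁻¹' S) α = q ⁻¹' T := by
  have single : ∀ S a, ∃ T, 𝒢.Sets T ∧ Γ.relRange (q ⁻¹' S) [a] = q ⁻¹' T := by
    intro S a
    by_cases ha : 𝒢.src a ∈ S
    · exact ⟨_, .rng a, h.relRange_single_of_mem ha⟩
    · exact ⟨_, .empty, h.relRange_single_of_notMem ha⟩
  induction α generalizing S with
  | nil => exact absurd rfl hα
  | cons a α ih =>
    rcases eq_or_ne α [] with rfl | hα'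
    · exact single S a
    · obtain ⟨T, _, hT⟩ := single S a
      obtain ⟨T', hT', hT''⟩ := ih T hα'
      refine ⟨T', hT', ?_⟩
      rw [← hT'', ← hT]
      ext w
      constructor
      · rintro ⟨v, hv, hp⟩
        cases hp with
        | single _ => exact absurd rfl hα'
        | cons e hp => exact ⟨_, ⟨_, hv, .single e⟩, hp⟩
      · rintro ⟨v, ⟨v', hv', hp'⟩, hp⟩
        obtain ⟨f, rfl, rfl, rfl⟩ := path_single_iff.1 hp'
        exact ⟨_, hv', .cons f hp⟩

/-- If the sources and sinks are alone in their fibres, then `ℰ⁰` consists of the inverse images of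
the members of `𝒢⁰`. -/
theorem space_sets (hiso : ∀ v w, (Γ.IsSource v ∨ Γ.IsSink v) → q w = q v → w = v) :
    Γ.space.sets = {D | ∃ S, 𝒢.Sets S ∧ D = q ⁻¹' S} := by
  have language_ne : ∀ α ∈ Γ.language, α ≠ [] := by
    rintro _ ⟨v, w, hp⟩ rfl
    cases hp
  ext D
  constructor
  · intro hD
    refine hD _ ⟨⟨∅, .empty, rfl⟩, ?_, ?_, ?_, ?_⟩ ?_
    · rintro _ ⟨S, hS, rfl⟩ _ ⟨T, hT, rfl⟩
      exact ⟨S ∩ T, .inter hS hT, rfl⟩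
    · rintro _ ⟨S, hS, rfl⟩ _ ⟨T, hT, rfl⟩
      exact ⟨S ∪ T, .union hS hT, rfl⟩
    · intro α hα
      obtain ⟨T, hT, hT'⟩ := h.relRange_mem_preimages Set.univ (language_ne α hα)
      exact ⟨T, hT, by rw [← hT']; simp [ranges, relRange]⟩
    · rintro _ ⟨S, -, rfl⟩ α hα
      exact h.relRange_mem_preimages S (language_ne α hα)
    · rintro _ ((⟨v, hv, rfl⟩ | ⟨α, hα, rfl⟩) | ⟨α, hα, rfl⟩)
      · refine ⟨{q v}, .singleton _, ?_⟩
        ext w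
        exact ⟨fun hw => congrArg q hw, hiso v w hv⟩
      · obtain ⟨T, hT, hT'⟩ := h.relRange_mem_preimages Set.univ (language_ne α hα)
        exact ⟨T, hT, by rw [← hT']; simp [ranges, relRange]⟩
      · cases α with
        | nil => exact absurd rfl (language_ne _ hα)
        | cons a α => exact ⟨_, .singleton _, h.sources_eq hα⟩
  · rintro ⟨S, hS, rfl⟩ C hC hbasic
    induction hS with
    | empty => exact hC.empty_mem
    | singleton u =>
      -- If `u` emits an edge `a`, its fibre is `s(a)`. Otherwise its fibre consists of sinks, hence
      -- of a single one, whose singleton is a basic set.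
      by_cases hu : ∃ a, 𝒢.src a = u
      · obtain ⟨a, rfl⟩ := hu
        have ha := Γ.single_mem_language ⟨a, h.lab_surjective a⟩
        rw [← h.sources_eq ha]
        exact hbasic (.inr ⟨_, ha, rfl⟩)
      · obtain ⟨w, rfl⟩ := h.surjective u
        have hw : Γ.IsSink w := (h.isSink_iff w).2 fun a ha => hu ⟨a, ha⟩
        have : q ⁻¹' {q w} = {w} := by
          ext v
          exact ⟨hiso w v (.inr hw), fun hv => congrArg q hv⟩
        rw [this]
        exact hbasic (.inl (.inl ⟨w, .inr hw, rfl⟩))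
    | rng e =>
      rw [← h.ranges_single]
      exact hC.ranges_mem _ (Γ.single_mem_language ⟨e, h.lab_surjective e⟩)
    | inter _ _ ih ih' => exact hC.inter_mem _ ih _ ih'
    | union _ _ ih ih' => exact hC.union_mem _ ih _ ih'

variable {L : LabelledSpace Γ} (hL : L.sets = {D | ∃ S, 𝒢.Sets S ∧ D = q ⁻¹' S})

/-- The members of the collection of a labelled space over an ultragraph. -/
def membersEquiv : 𝒢.Members ≃ L.sets :=
  Equiv.ofBijective (fun S => ⟨q ⁻¹' S.1, by rw [hL]; exact ⟨S.1, S.2, rfl⟩⟩) <| by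
    constructor
    · intro S T hST
      exact Subtype.ext (h.surjective.preimage_injective (congrArg Subtype.val hST))
    · rintro ⟨D, hD⟩
      have hD' := hD
      rw [hL] at hD'
      obtain ⟨S, hS, rfl⟩ := hD'
      exact ⟨⟨S, hS⟩, rfl⟩

/-- The labels of a labelled graph over an ultragraph are the edges of the latter. -/
def labelEquiv : X ≃ Set.range Γ.lab :=
  (Equiv.Set.univ X).symm.trans (Equiv.setCongr h.lab_surjective.range_eq.symm)

theorem mem_labelsFrom_membersEquiv (S : 𝒢.Members) (a : X) :
    h.labelEquiv a ∈ Γ.labelsFrom (h.membersEquiv hL S).1 ↔ 𝒢.src a ∈ S.1 :=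
  h.mem_labelsFrom_iff S.1 (h.labelEquiv a)

theorem space_range (a : X) :
    L.range (h.labelEquiv a) = h.membersEquiv hL ⟨𝒢.rng a, .rng a⟩ :=
  Subtype.ext (h.ranges_single a)

theorem space_relRange_of_mem {S : 𝒢.Members} {a : X} (ha : 𝒢.src a ∈ S.1) :
    L.relRange (h.membersEquiv hL S) (h.labelEquiv a) =
      h.membersEquiv hL ⟨𝒢.rng a, .rng a⟩ :=
  Subtype.ext (h.relRange_single_of_mem ha)

theorem space_relRange_of_notMem {S : 𝒢.Members} {a : X} (ha : 𝒢.src a ∉ S.1) :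
    L.relRange (h.membersEquiv hL S) (h.labelEquiv a) = L.empty :=
  Subtype.ext (h.relRange_single_of_notMem ha)

variable {B : Type u} [NonUnitalCStarAlgebra B] {p : L.sets → B} {s : Set.range Γ.lab → B}

/-- The labelled relations are specialised to `D = q⁻¹{v}`. Commuting `p_D` past `s_e` with `v =
s(e)` gives `s_e s_e* ≤ p_{s(e)}`. The labels leaving `D` are the edges emitted by `v`, and `D`
contains no sink if `v` emits an edge. -/
theorem isCuntzKrieger_of_isRepresentation (hr : L.IsRepresentation p s) :
    𝒢.IsCuntzKrieger (p ∘ h.membersEquiv hL) (s ∘ h.labelEquiv) where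
  proj _ := hr.proj _
  partialIsometry _ := hr.partialIsometry _
  range_orthogonal e f hef := hr.range_orthogonal _ _ (h.labelEquiv.injective.ne hef)
  map_empty := hr.map_empty
  map_inter _ _ := hr.map_inter _ _
  map_union D D' := hr.map_union (h.membersEquiv hL D) (h.membersEquiv hL D')
  star_mul_self e := by
    simp only [Function.comp_apply]
    rw [hr.star_mul_self, h.space_range hL]
  range_le e := by
    simp only [Function.comp_apply]
    rw [← mul_assoc, hr.proj_mul, h.space_relRange_of_mem hL (Set.mem_singleton _), ← h.space_range hL,
      ← hr.star_mul_self, ← mul_assoc, hr.partialIsometry]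
  sum_eq v hfin hne := by
    set D := h.membersEquiv hL ⟨{v}, .singleton v⟩ with hD
    have hfin' : (Γ.labelsFrom D.1).Finite := by
      refine (hfin.image h.labelEquiv).subset fun a ha => ?_
      obtain ⟨a, rfl⟩ := h.labelEquiv.surjective a
      exact ⟨a, (h.mem_labelsFrom_membersEquiv hL _ a).1 ha, rfl⟩
    obtain ⟨e, he⟩ := hne
    have hsum := hr.sum_eq D (fun w hw hsink => (h.isSink_iff w).1 hsink e (Eq.trans he hw.symm))
      hfin' ⟨h.labelEquiv e, (h.mem_labelsFrom_membersEquiv hL _ e).2 he⟩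
    simp only [Function.comp_apply]
    rw [hsum]
    symm
    refine Finset.sum_bij (fun a _ => h.labelEquiv a) ?_ ?_ ?_ ?_
    · intro a ha
      rw [Set.Finite.mem_toFinset] at ha ⊢
      exact (h.mem_labelsFrom_membersEquiv hL _ a).2 ha
    · intro a _ b _ hab
      exact h.labelEquiv.injective hab
    · intro a ha
      obtain ⟨a, rfl⟩ := h.labelEquiv.surjective a
      rw [Set.Finite.mem_toFinset] at ha
      exact ⟨a, by simpa using (h.mem_labelsFrom_membersEquiv hL _ a).1 ha, rfl⟩
    · intro a ha
      rw [Set.Finite.mem_toFinset] at ha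
      rw [h.space_relRange_of_mem hL ha, ← h.space_range hL, ← hr.star_mul_self, ← mul_assoc,
        hr.partialIsometry]

/-- The substance is the sum relation, which the `𝒢`-family provides only for single vertices. If
`q⁻¹S` contains no sink, every vertex of `S` emits an edge; if only finitely many labels leave it,
`S` is finite and its vertices emit finitely many edges. The vertex relations then add up over `S`.
-/
theorem isRepresentation_of_isCuntzKrieger
    (hr : 𝒢.IsCuntzKrieger (p ∘ h.membersEquiv hL) (s ∘ h.labelEquiv)) :
    L.IsRepresentation p s where
  proj D := by
    obtain ⟨S, rfl⟩ := (h.membersEquiv hL).surjective D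
    exact hr.proj S
  partialIsometry a := by
    obtain ⟨a, rfl⟩ := h.labelEquiv.surjective a
    exact hr.partialIsometry a
  map_empty := hr.map_empty
  map_inter D D' := by
    obtain ⟨S, rfl⟩ := (h.membersEquiv hL).surjective D
    obtain ⟨S', rfl⟩ := (h.membersEquiv hL).surjective D'
    exact hr.map_inter S S'
  map_union D D' := by
    obtain ⟨S, rfl⟩ := (h.membersEquiv hL).surjective D
    obtain ⟨S', rfl⟩ := (h.membersEquiv hL).surjective D'
    exact hr.map_union S S'
  proj_mul D a := by
    classical
    obtain ⟨S, rfl⟩ := (h.membersEquiv hL).surjective D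
    obtain ⟨a, rfl⟩ := h.labelEquiv.surjective a
    have hm := hr.proj_mul S a
    simp only [Function.comp_apply] at hm
    rw [hm]
    split_ifs with ha
    · rw [h.space_relRange_of_mem hL ha]
      exact (hr.mul_range a).symm
    · rw [h.space_relRange_of_notMem hL ha]
      have h0 : p L.empty = 0 := hr.map_empty
      rw [h0, mul_zero]
  star_mul_self a := by
    obtain ⟨a, rfl⟩ := h.labelEquiv.surjective a
    rw [h.space_range hL]
    exact hr.star_mul_self a
  range_orthogonal a b hab := by
    obtain ⟨a, rfl⟩ := h.labelEquiv.surjective a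
    obtain ⟨b, rfl⟩ := h.labelEquiv.surjective b
    exact hr.range_orthogonal a b fun H => hab (congrArg _ H)
  sum_eq D hD hfin _ := by
    have : DecidableEq U := Classical.decEq U
    obtain ⟨S, rfl⟩ := (h.membersEquiv hL).surjective D
    have hemit : ∀ v ∈ S.1, {e | 𝒢.src e = v}.Nonempty := by
      intro v hv
      obtain ⟨w, rfl⟩ := h.surjective v
      have := hD w hv
      rw [h.isSink_iff] at this
      push Not at this
      exact this
    have hfinX : {e | 𝒢.src e ∈ S.1}.Finite := by
      refine (hfin.preimage (h.labelEquiv.injective.injOn)).subset fun e he => ?_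
      exact (h.mem_labelsFrom_membersEquiv hL S e).2 he
    have hfin1 : ∀ v ∈ S.1, {e | 𝒢.src e = v}.Finite := by
      rintro v hv
      refine hfinX.subset ?_
      rintro e rfl
      exact hv
    have hSfin : S.1.Finite := (hfinX.image 𝒢.src).subset fun v hv => by
      obtain ⟨e, rfl⟩ := hemit v hv
      exact ⟨e, hv, rfl⟩
    obtain ⟨S, hS⟩ := S
    lift S to Finset U using hSfin
    have h1 := hr.vertex_sum S hS
    simp only [Function.comp_apply] at h1
    rw [h1]
    have h2 : ∀ v ∈ S, p (h.membersEquiv hL ⟨{v}, .singleton v⟩) =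
        ∑ e ∈ hfinX.toFinset with 𝒢.src e = v, s (h.labelEquiv e) * star (s (h.labelEquiv e)) := by
      intro v hv
      have h3 := hr.sum_eq v (hfin1 v hv) (hemit v hv)
      simp only [Function.comp_apply] at h3
      rw [h3]
      refine Finset.sum_congr ?_ fun _ _ => rfl
      ext e
      simp only [Set.Finite.mem_toFinset, Set.mem_ofPred_eq, Finset.mem_filter]
      exact ⟨fun he => ⟨he ▸ hv, he⟩, fun he => he.2⟩
    -- The edges emitted by `S` are regrouped by their source.
    rw [Finset.sum_congr rfl h2, Finset.sum_fiberwise_of_maps_to (g := 𝒢.src) (fun e he => by simpa using he)]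
    refine Finset.sum_bij (fun a _ => h.labelEquiv a) ?_ ?_ ?_ ?_
    · intro a ha
      rw [Set.Finite.mem_toFinset] at ha ⊢
      exact (h.mem_labelsFrom_membersEquiv hL _ a).2 ha
    · intro a _ b _ hab
      exact h.labelEquiv.injective hab
    · intro a ha
      obtain ⟨a, rfl⟩ := h.labelEquiv.surjective a
      rw [Set.Finite.mem_toFinset] at ha
      exact ⟨a, by simpa using (h.mem_labelsFrom_membersEquiv hL _ a).1 ha, rfl⟩
    · intro a ha
      rw [Set.Finite.mem_toFinset] at ha
      rw [h.space_relRange_of_mem hL ha]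
      congr 1
      exact (hr.mul_range a).symm

include hL in
/-- The C*-algebra of a labelled space over an ultragraph is the ultragraph algebra. -/
theorem nonempty_equiv : Nonempty (L.CStar ≃⋆ₐ[ℂ] 𝒢.CStar) := by
  obtain ⟨φ⟩ := Relations.nonempty_equiv_of_reindex (R := 𝒢.relations) (R' := L.relations)
    (Equiv.sumCongr (h.membersEquiv hL) h.labelEquiv)
    fun f => ⟨fun hf => h.isCuntzKrieger_of_isRepresentation hL hf,
      fun hf => h.isRepresentation_of_isCuntzKrieger (p := fun D => f (.inl D))
        (s := fun a => f (.inr a)) hL hf⟩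
  exact ⟨φ.symm⟩

end LiesOver

end LabelledGraph

/-! ### Sums of orthogonal projections and of range projections. -/

section OrthogonalSums

variable {ι B : Type*} [DecidableEq ι] [NonUnitalCStarAlgebra B] {P : ι → B}

theorem sum_mul_sum_of_orthogonal (h : ∀ i j, P i * P j = if i = j then P i else 0)
    (S T : Finset ι) : (∑ i ∈ S, P i) * ∑ i ∈ T, P i = ∑ i ∈ S ∩ T, P i := by
  simp only [Finset.sum_mul_sum, h, Finset.sum_ite_eq, Finset.sum_ite_mem]

end OrthogonalSums

namespace DirectedGraph.IsCuntzKrieger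

variable {V X : Type u} {E : DirectedGraph V X} {B : Type u} [NonUnitalCStarAlgebra B]
  {p : V → B} {s : X → B}

theorem vertex_mul [DecidableEq V] (h : E.IsCuntzKrieger p s) (v : V) (e : X) :
    p v * s e = if E.src e = v then s e else 0 := by
  have h1 : p (E.src e) * s e = s e := by
    conv_lhs => rw [← h.partialIsometry e, ← mul_assoc, h.range_le]
    exact h.partialIsometry e
  split_ifs with hv
  · rw [← hv, h1]
  · rw [← h1, ← mul_assoc, h.orthogonal _ _ (Ne.symm hv), zero_mul]

theorem range_mul [DecidableEq X] (h : E.IsCuntzKrieger p s) (e f : X) :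
    s e * star (s e) * s f = if e = f then s f else 0 := by
  split_ifs with hef
  · rw [hef, h.partialIsometry]
  · rw [mul_assoc, h.range_orthogonal e f hef, mul_zero]

theorem sum_range_mul [DecidableEq X] (h : E.IsCuntzKrieger p s) (S : Finset X) (f : X) :
    (∑ e ∈ S, s e * star (s e)) * s f = if f ∈ S then s f else 0 := by
  simp only [Finset.sum_mul, h.range_mul, Finset.sum_ite_eq']

theorem star_sum_range (S : Finset X) :
    star (∑ e ∈ S, s e * star (s e)) = ∑ e ∈ S, s e * star (s e) := by
  simp [star_sum]

theorem vertex_mul_sum_range [DecidableEq V] (h : E.IsCuntzKrieger p s) (v : V) (S : Finset X) :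
    p v * ∑ e ∈ S, s e * star (s e) = ∑ e ∈ S with E.src e = v, s e * star (s e) := by
  simp only [Finset.mul_sum, ← mul_assoc, h.vertex_mul, ite_mul, zero_mul, Finset.sum_filter]

theorem sum_range_mul_vertex [DecidableEq V] (h : E.IsCuntzKrieger p s) (v : V) (S : Finset X) :
    (∑ e ∈ S, s e * star (s e)) * p v = ∑ e ∈ S with E.src e = v, s e * star (s e) := by
  rw [← star_sum_range (s := s) (S.filter _), ← h.vertex_mul_sum_range, star_mul, star_sum_range,
    (h.proj v).isSelfAdjoint.star_eq]

end DirectedGraph.IsCuntzKrieger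

/-! ### Splitting the vertices of a graph. -/

/-- The vertices of the graph `E` are split into those of an ultragraph `𝒢` with the same edges:
the vertices `u` over `v` distribute the edges emitted by `v` among each other, an edge of `𝒢` ends
in all vertices over its range in `E`, and all vertices over `v`, with the possible exception of
`d v`, emit finitely many edges, and at least one. -/
structure Ultragraph.Splits {U V X : Type u} (𝒢 : Ultragraph U X) (E : DirectedGraph V X)
    (b : U → V) (d : V → U) : Prop where
  finite_fibre : ∀ v, (b ⁻¹' {v}).Finite
  base_section : ∀ v, b (d v) = v
  base_src : ∀ e, b (𝒢.src e) = E.src e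
  rng_eq : ∀ e, 𝒢.rng e = b ⁻¹' {E.rng e}
  finite_emit : ∀ u, u ≠ d (b u) → {e | 𝒢.src e = u}.Finite
  nonempty_emit : ∀ u, u ≠ d (b u) → {e | 𝒢.src e = u}.Nonempty
  nonempty_emit_section : ∀ v, {e | E.src e = v}.Finite → {e | E.src e = v}.Nonempty →
    {e | 𝒢.src e = d v}.Nonempty

namespace Ultragraph.Splits

variable {U V X : Type u} {𝒢 : Ultragraph U X} {E : DirectedGraph V X} {b : U → V} {d : V → U}
  (h : 𝒢.Splits E b d)
include h

/-- This finiteness is what makes the projection of `d v` definable when `v` emits infinitely many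
edges: only a finite sum is subtracted from `p_v`. -/
theorem finite_offSection (v : V) : {e | E.src e = v ∧ 𝒢.src e ≠ d v}.Finite := by
  have : {e | E.src e = v ∧ 𝒢.src e ≠ d v} ⊆
      ⋃ u ∈ b ⁻¹' {v} \ {d v}, {e | 𝒢.src e = u} := by
    rintro e ⟨rfl, he⟩
    exact Set.mem_biUnion (x := 𝒢.src e) ⟨h.base_src e, he⟩ rfl
  refine (((h.finite_fibre v).sdiff).biUnion fun u hu => h.finite_emit u ?_).subset this
  rintro hd
  exact hu.2 (hd.trans (congrArg d hu.1))

theorem finite_member (D : 𝒢.Members) : D.1.Finite :=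
  finite_of_sets (fun e => h.rng_eq e ▸ h.finite_fibre _) D.2

/-- The finitely many edges emitted by `v` in `E`, but not by `d v` in `𝒢`. -/
def offSection (v : V) : Finset X := (h.finite_offSection v).toFinset

theorem mem_offSection {v : V} {e : X} :
    e ∈ h.offSection v ↔ E.src e = v ∧ 𝒢.src e ≠ d v := by
  simp [offSection]

/-- The vertices over `v`, as a finite set. -/
def fibre (v : V) : Finset U := (h.finite_fibre v).toFinset

theorem mem_fibre {v : V} {u : U} : u ∈ h.fibre v ↔ b u = v := by
  simp [fibre]

/-- The fibre `b⁻¹(v)`, as a member of `𝒢⁰`. -/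
def fibreMember (v : V) : 𝒢.Members := ⟨b ⁻¹' {v}, sets_of_finite (h.finite_fibre v)⟩

open Classical in
/-- The projection of a vertex of `𝒢` in terms of a Cuntz–Krieger `E`-family. -/
def vertexProj {B : Type*} [NonUnitalCStarAlgebra B] (p : V → B) (s : X → B) (u : U) : B :=
  if u = d (b u) then p (b u) - ∑ e ∈ h.offSection (b u), s e * star (s e)
  else ∑ e ∈ h.offSection (b u) with 𝒢.src e = u, s e * star (s e)

/-- Used to evaluate in each model the formula written in the universal C*-algebra. -/
theorem map_vertexProj {B C : Type*} [NonUnitalCStarAlgebra B] [NonUnitalCStarAlgebra C]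
    (φ : B →⋆ₙₐ[ℂ] C) (p : V → B) (s : X → B) (u : U) :
    φ (h.vertexProj p s u) = h.vertexProj (fun v => φ (p v)) (fun e => φ (s e)) u := by
  unfold vertexProj
  split_ifs <;> simp [map_sum, map_sub, map_mul, map_star]

variable {B : Type u} [NonUnitalCStarAlgebra B]

section FromGraph

variable {p : V → B} {s : X → B}

theorem vertexProj_section (v : V) :
    h.vertexProj p s (d v) = p v - ∑ e ∈ h.offSection v, s e * star (s e) := by
  simp [vertexProj, h.base_section]

open Classical in
theorem vertexProj_of_ne {u : U} (hu : u ≠ d (b u)) :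
    h.vertexProj p s u = ∑ e ∈ h.offSection (b u) with 𝒢.src e = u, s e * star (s e) :=
  if_neg hu

theorem src_eq_of_mem_offSection {v : V} {e : X} (he : e ∈ h.offSection v) : E.src e = v :=
  (h.mem_offSection.1 he).1

theorem mem_offSection_of_ne {u : U} (hu : u ≠ d (b u)) {e : X} (he : 𝒢.src e = u) :
    e ∈ h.offSection (b u) := by
  subst he
  exact h.mem_offSection.2 ⟨(h.base_src e).symm, hu⟩

/-- The vertices other than `d v` share out the edges of `offSection v` by their source in `𝒢`, so
together they restore the sum subtracted at `d v`. -/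
theorem sum_vertexProj (v : V) : ∑ u ∈ h.fibre v, h.vertexProj p s u = p v := by
  classical
  rw [← Finset.add_sum_erase _ _ (h.mem_fibre.2 (h.base_section v)), h.vertexProj_section]
  have h1 : ∀ u ∈ (h.fibre v).erase (d v), h.vertexProj p s u =
      ∑ e ∈ h.offSection v with 𝒢.src e = u, s e * star (s e) := by
    intro u hu
    rw [Finset.mem_erase, h.mem_fibre] at hu
    obtain ⟨hu, rfl⟩ := hu
    exact h.vertexProj_of_ne hu
  rw [Finset.sum_congr rfl h1, Finset.sum_fiberwise_of_maps_to (g := 𝒢.src), sub_add_cancel]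
  intro e he
  rw [h.mem_offSection] at he
  rw [Finset.mem_erase, h.mem_fibre, h.base_src]
  exact ⟨he.2, he.1⟩

variable (hr : E.IsCuntzKrieger p s)
include hr

theorem star_vertexProj (u : U) : star (h.vertexProj p s u) = h.vertexProj p s u := by
  unfold vertexProj
  split_ifs
  · rw [star_sub, (hr.proj _).isSelfAdjoint.star_eq,
      DirectedGraph.IsCuntzKrieger.star_sum_range]
  · exact DirectedGraph.IsCuntzKrieger.star_sum_range _

open Classical in
theorem vertexProj_mul_edge (u : U) (e : X) :
    h.vertexProj p s u * s e = if 𝒢.src e = u then s e else 0 := by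
  by_cases hu : u = d (b u)
  · rw [hu, h.vertexProj_section, sub_mul, hr.vertex_mul, hr.sum_range_mul]
    simp only [h.mem_offSection]
    by_cases h1 : E.src e = b u
    · by_cases h2 : 𝒢.src e = d (b u) <;> simp [h1, h2]
    · have h2 : 𝒢.src e ≠ d (b u) := fun h2 => h1 <| by
        rw [← h.base_src, h2, h.base_section]
      simp [h1, h2]
  · rw [h.vertexProj_of_ne hu, hr.sum_range_mul]
    congr 1
    rw [Finset.mem_filter, eq_iff_iff]
    exact ⟨fun he => he.2, fun he => ⟨h.mem_offSection_of_ne hu he, he⟩⟩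

open Classical in
theorem vertexProj_mul_vertex (u : U) (v : V) :
    h.vertexProj p s u * p v = if b u = v then h.vertexProj p s u else 0 := by
  have hfilter : ∀ S ⊆ h.offSection (b u), (∑ e ∈ S with E.src e = v, s e * star (s e)) =
      if b u = v then ∑ e ∈ S, s e * star (s e) else 0 := by
    intro S hS
    split_ifs with hv
    · rw [Finset.filter_true_of_mem fun e he => (h.src_eq_of_mem_offSection (hS he)).trans hv]
    · rw [Finset.filter_false_of_mem fun e he he' =>
        hv ((h.src_eq_of_mem_offSection (hS he)).symm.trans he'), Finset.sum_empty]
  have hp : p (b u) * p v = if b u = v then p (b u) else 0 := by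
    split_ifs with hv
    · rw [← hv, (hr.proj _).isIdempotentElem]
    · exact hr.orthogonal _ _ hv
  unfold vertexProj
  by_cases hu : u = d (b u)
  · rw [if_pos hu, sub_mul, hr.sum_range_mul_vertex, hfilter _ subset_rfl, hp]
    split_ifs <;> simp
  · rw [if_neg hu, hr.sum_range_mul_vertex, hfilter _ (Finset.filter_subset _ _)]

open Classical in
theorem vertexProj_mul_sum_range (u : U) (S : Finset X) :
    h.vertexProj p s u * ∑ e ∈ S, s e * star (s e) =
      ∑ e ∈ S with 𝒢.src e = u, s e * star (s e) := by
  simp only [Finset.mul_sum, ← mul_assoc, h.vertexProj_mul_edge hr, ite_mul, zero_mul,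
    Finset.sum_filter]

-- Only the right factor is expanded, into a vertex projection and range projections, whose products
-- with the left factor are known.
open Classical in
theorem vertexProj_mul_vertexProj (u u' : U) : h.vertexProj p s u * h.vertexProj p s u' =
    if u = u' then h.vertexProj p s u else 0 := by
  by_cases hu' : u' = d (b u')
  · rw [hu', h.vertexProj_section, mul_sub, h.vertexProj_mul_vertex hr,
      h.vertexProj_mul_sum_range hr]
    by_cases hu : u = d (b u)
    · have h0 : ∑ e ∈ h.offSection (b u') with 𝒢.src e = u, s e * star (s e) = 0 := by
        rw [Finset.filter_false_of_mem, Finset.sum_empty]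
        rintro e he rfl
        have he' := h.mem_offSection.1 he
        rw [h.base_src, he'.1] at hu
        exact he'.2 hu
      rw [h0, sub_zero]
      congr 1
      rw [eq_iff_iff]
      exact ⟨fun hb => hb ▸ hu, fun hb => by rw [hb, h.base_section]⟩
    -- For `u` in the same fibre as `u' = d (b u')` but different from it, `p_v` fixes the
    -- projection of `u`, and the part of the subtracted sum with source `u` is that same
    -- projection, so the two cancel.
    · by_cases hb : b u = b u'
      · rw [if_pos hb, if_neg (by rwa [← hb]), h.vertexProj_of_ne hu, hb, sub_self]
      · rw [if_neg hb, Finset.filter_false_of_mem, Finset.sum_empty, sub_zero, if_neg]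
        · rintro rfl
          exact hb (h.base_section _)
        · rintro e he rfl
          exact hb ((h.base_src e).trans (h.src_eq_of_mem_offSection he))
  · rw [h.vertexProj_of_ne hu', h.vertexProj_mul_sum_range hr, Finset.filter_filter]
    split_ifs with hu
    · subst hu
      rw [h.vertexProj_of_ne hu']
      simp
    · rw [Finset.filter_false_of_mem, Finset.sum_empty]
      rintro e - ⟨h1, h2⟩
      exact hu (h2.symm.trans h1)

/-- For `u = d v` emitting finitely many edges, `v` emits finitely many as well, since `offSection
v` is finite. Subtracting `offSection v` from the Cuntz–Krieger relation at `v` leaves the edges of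
`u`. -/
theorem vertexProj_eq_sum (u : U) (hfin : {e | 𝒢.src e = u}.Finite)
    (hne : {e | 𝒢.src e = u}.Nonempty) :
    h.vertexProj p s u = ∑ e ∈ hfin.toFinset, s e * star (s e) := by
  classical
  by_cases hu : u = d (b u)
  · have hfinE : {e | E.src e = b u}.Finite := by
      refine (hfin.union (h.finite_offSection (b u))).subset fun e he => ?_
      by_cases hd : 𝒢.src e = d (b u)
      · exact .inl (hd.trans hu.symm)
      · exact .inr ⟨he, hd⟩
    have hneE : {e | E.src e = b u}.Nonempty := by
      obtain ⟨e, rfl⟩ := hne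
      exact ⟨e, (h.base_src e).symm⟩
    conv_lhs => rw [hu]
    rw [h.vertexProj_section, hr.sum_eq _ hfinE hneE, sub_eq_iff_eq_add, ← Finset.sum_union]
    · refine Finset.sum_congr ?_ fun _ _ => rfl
      ext e
      simp only [Set.Finite.mem_toFinset, Set.mem_ofPred_eq, Finset.mem_union, h.mem_offSection]
      constructor
      · intro he
        by_cases hd : 𝒢.src e = d (b u)
        · exact .inl (hd.trans hu.symm)
        · exact .inr ⟨he, hd⟩
      · rintro (rfl | he)
        · exact (h.base_src e).symm
        · exact he.1
    · rw [Finset.disjoint_left]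
      intro e he he'
      rw [Set.Finite.mem_toFinset] at he
      exact (h.mem_offSection.1 he').2 (Eq.trans he hu)
  · rw [h.vertexProj_of_ne hu]
    refine Finset.sum_congr ?_ fun _ _ => rfl
    ext e
    simp only [Set.Finite.mem_toFinset, Set.mem_ofPred_eq, Finset.mem_filter]
    exact ⟨fun he => he.2, fun he => ⟨h.mem_offSection_of_ne hu he, he⟩⟩

theorem isCuntzKrieger_of_graph :
    𝒢.IsCuntzKrieger (fun D => ∑ u ∈ (h.finite_member D).toFinset, h.vertexProj p s u) s := by
  classical
  have hmul : ∀ D D' : 𝒢.Members, (∑ u ∈ (h.finite_member D).toFinset, h.vertexProj p s u) *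
      (∑ u ∈ (h.finite_member D').toFinset, h.vertexProj p s u) =
      ∑ u ∈ (h.finite_member ⟨D.1 ∩ D'.1, .inter D.2 D'.2⟩).toFinset, h.vertexProj p s u := by
    intro D D'
    rw [sum_mul_sum_of_orthogonal (h.vertexProj_mul_vertexProj hr)]
    refine Finset.sum_congr ?_ fun _ _ => rfl
    ext u
    simp
  exact
    { proj := fun D => ⟨by
          change _ * _ = _
          rw [sum_mul_sum_of_orthogonal (h.vertexProj_mul_vertexProj hr), Finset.inter_self], by
          rw [IsSelfAdjoint, star_sum]
          exact Finset.sum_congr rfl fun u _ => h.star_vertexProj hr u⟩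
      partialIsometry := hr.partialIsometry
      range_orthogonal := hr.range_orthogonal
      map_empty := by simp
      map_inter := hmul
      map_union := fun D D' => by
        rw [eq_sub_iff_add_eq, ← Finset.sum_union_inter (s₁ := (h.finite_member D).toFinset)]
        congr 1 <;> refine Finset.sum_congr ?_ fun _ _ => rfl <;> ext u <;> simp
      star_mul_self := fun e => by
        rw [hr.star_mul_self, ← h.sum_vertexProj (p := p) (s := s)]
        refine Finset.sum_congr ?_ fun _ _ => rfl
        ext u
        simp [h.mem_fibre, h.rng_eq]
      range_le := fun e => by
        simp [← mul_assoc, h.vertexProj_mul_edge hr]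
      sum_eq := fun u hfin hne => by
        rw [← h.vertexProj_eq_sum hr u hfin hne]
        simp }

end FromGraph

section ToGraph

variable {p : 𝒢.Members → B} {s : X → B} (hr : 𝒢.IsCuntzKrieger p s)
include hr

theorem fibreMember_sum (v : V) :
    p (h.fibreMember v) = ∑ u ∈ h.fibre v, p ⟨{u}, .singleton u⟩ := by
  have hS : 𝒢.Sets (h.fibre v : Set U) := sets_of_finite (h.fibre v).finite_toSet
  rw [← hr.vertex_sum _ hS]
  congr 1
  apply Subtype.ext
  ext u
  simp [fibreMember, h.mem_fibre]

/-- If `v` emits finitely many edges, and at least one, so does every vertex over it in `𝒢`, by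
`nonempty_emit_section` at `d v`. Adding their relations gives the relation at `v`. -/
theorem isCuntzKrieger_toGraph : E.IsCuntzKrieger (fun v => p (h.fibreMember v)) s where
  proj _ := hr.proj _
  orthogonal v w hvw := by
    rw [hr.map_inter, ← hr.map_empty]
    congr 1
    apply Subtype.ext
    ext u
    exact ⟨fun hu => hvw (Eq.trans (Eq.symm hu.1) hu.2), False.elim⟩
  partialIsometry := hr.partialIsometry
  star_mul_self e := by
    rw [hr.star_mul_self]
    congr 1
    exact Subtype.ext (h.rng_eq e)
  range_le e := by
    classical
    rw [← mul_assoc, hr.proj_mul, if_pos]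
    exact h.base_src e
  range_orthogonal := hr.range_orthogonal
  sum_eq v hfin hne := by
    have : DecidableEq U := Classical.decEq U
    rw [h.fibreMember_sum hr]
    have hfinu : ∀ u ∈ h.fibre v, {e | 𝒢.src e = u}.Finite := by
      intro u hu
      refine hfin.subset ?_
      rintro e rfl
      exact (h.base_src e).symm.trans (h.mem_fibre.1 hu)
    have hsum : ∀ u ∈ h.fibre v, p ⟨{u}, .singleton u⟩ =
        ∑ e ∈ hfin.toFinset with 𝒢.src e = u, s e * star (s e) := by
      intro u hu
      have hne' : {e | 𝒢.src e = u}.Nonempty := by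
        have hv := h.mem_fibre.1 hu
        by_cases hd : u = d (b u)
        · rw [hd, hv]
          exact h.nonempty_emit_section v hfin hne
        · exact h.nonempty_emit u hd
      rw [hr.sum_eq u (hfinu u hu) hne']
      refine Finset.sum_congr ?_ fun _ _ => rfl
      ext e
      simp only [Set.Finite.mem_toFinset, Set.mem_ofPred_eq, Finset.mem_filter]
      refine ⟨fun he => ⟨?_, he⟩, fun he => he.2⟩
      rw [← h.base_src, he, h.mem_fibre.1 hu]
    rw [Finset.sum_congr rfl hsum, Finset.sum_fiberwise_of_maps_to (g := 𝒢.src)]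
    intro e he
    rw [Set.Finite.mem_toFinset] at he
    rw [h.mem_fibre, h.base_src]
    exact he

/-- Off the section both sides are the sum of the range projections of the edges emitted by `u`. No
such relation need hold at `d v`; there the equality follows by subtraction, as both families have
the same sum over the fibre. -/
theorem vertexProj_fibreMember (u : U) :
    h.vertexProj (fun v => p (h.fibreMember v)) s u = p ⟨{u}, .singleton u⟩ := by
  classical
  have hne : ∀ u, u ≠ d (b u) → h.vertexProj (fun v => p (h.fibreMember v)) s u =
      p ⟨{u}, .singleton u⟩ := by
    intro u hu
    rw [hr.sum_eq u (h.finite_emit u hu) (h.nonempty_emit u hu)]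
    exact h.vertexProj_eq_sum (h.isCuntzKrieger_toGraph hr) u _ (h.nonempty_emit u hu)
  by_cases hu : u = d (b u)
  · have h1 := h.sum_vertexProj (p := fun v => p (h.fibreMember v)) (s := s) (b u)
    have hmem : u ∈ h.fibre (b u) := h.mem_fibre.2 rfl
    rw [h.fibreMember_sum hr, ← Finset.add_sum_erase _ _ hmem, ← Finset.add_sum_erase _ _ hmem,
      Finset.sum_congr rfl fun u' hu' => hne u' ?_] at h1
    · exact add_right_cancel h1
    · rw [Finset.mem_erase, h.mem_fibre] at hu'
      rw [hu'.2, ← hu]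
      exact hu'.1
  · exact hne u hu

end ToGraph

/-- The translation of Cuntz–Krieger `𝒢`-families into Cuntz–Krieger `E`-families. -/
def toGraph : Relations.Translation E.relations 𝒢.relations where
  map f := Sum.elim (fun v => f (.inl (h.fibreMember v))) (fun e => f (.inr e))
  holds _ hf := h.isCuntzKrieger_toGraph hf
  term := Sum.elim (fun v => 𝒢.relations.gen (.inl (h.fibreMember v)))
    (fun e => 𝒢.relations.gen (.inr e))
  eval_term M g := by rcases g with v | e <;> rfl

/-- The translation of Cuntz–Krieger `E`-families into Cuntz–Krieger `𝒢`-families. -/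
def fromGraph : Relations.Translation 𝒢.relations E.relations where
  map f := Sum.elim (fun D => ∑ u ∈ (h.finite_member D).toFinset,
    h.vertexProj (fun v => f (.inl v)) (fun e => f (.inr e)) u) (fun e => f (.inr e))
  holds _ hf := h.isCuntzKrieger_of_graph hf
  term := Sum.elim (fun D => ∑ u ∈ (h.finite_member D).toFinset,
    h.vertexProj (fun v => E.relations.gen (.inl v)) (fun e => E.relations.gen (.inr e)) u)
    (fun e => E.relations.gen (.inr e))
  eval_term M g := by
    rcases g with D | e
    · simp only [Sum.elim_inl, map_sum, h.map_vertexProj, Relations.eval_gen]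
    · rfl

/-- Splitting the vertices of a graph does not change the C*-algebra. -/
theorem nonempty_equiv : Nonempty (𝒢.CStar ≃⋆ₐ[ℂ] E.CStar) := by
  refine ⟨h.fromGraph.equiv h.toGraph (fun M => ?_) fun M => ?_⟩
  · funext g
    rcases g with D | e
    · have hD : 𝒢.Sets ((h.finite_member D).toFinset : Set U) := by
        rw [Set.Finite.coe_toFinset]
        exact D.2
      have h1 := Ultragraph.IsCuntzKrieger.vertex_sum M.holds _ hD
      have h2 : (⟨_, hD⟩ : 𝒢.Members) = D := Subtype.ext (Set.Finite.coe_toFinset _)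
      rw [h2] at h1
      refine Eq.trans (Finset.sum_congr rfl fun u _ => ?_) h1.symm
      exact h.vertexProj_fibreMember M.holds u
    · rfl
  · funext g
    rcases g with v | e
    · exact Eq.trans (Finset.sum_congr (by ext; simp [h.mem_fibre, fibreMember]) fun _ _ => rfl)
        (h.sum_vertexProj v)
    · rfl

end Ultragraph.Splits

/-! ### Coverings and trivial labellings. -/

/-- A directed graph as an ultragraph. -/
def DirectedGraph.toUltragraph {V X : Type u} (E : DirectedGraph V X) : Ultragraph V X where
  src := E.src
  rng e := {E.rng e}
  rng_nonempty _ := Set.singleton_nonempty _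

/-- With `d = id` there are no vertices off the section. This identifies `C*(E)` with the algebra of
`E` as an ultragraph. -/
theorem DirectedGraph.splits_toUltragraph {V X : Type u} (E : DirectedGraph V X) :
    E.toUltragraph.Splits E id id where
  finite_fibre v := Set.finite_singleton v
  base_section _ := rfl
  base_src _ := rfl
  rng_eq _ := rfl
  finite_emit _ h := absurd rfl h
  nonempty_emit _ h := absurd rfl h
  nonempty_emit_section _ _ h := h

/-- The trivial labelling is the labelling induced by the identity covering, whose fibres are single
vertices. -/
theorem DirectedGraph.isCovering_id {V X : Type u} (E : DirectedGraph V X) :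
    IsCovering E E id id where
  map_src _ := rfl
  map_rng _ := rfl
  surjective := Function.surjective_id
  bijOn_src _ := Set.bijOn_id _
  bijOn_rng _ := Set.bijOn_id _

namespace IsCovering

variable {V X W Y : Type u} {F : DirectedGraph W Y} {E : DirectedGraph V X}
  {p₀ : W → V} {p₁ : Y → X} (h : IsCovering F E p₀ p₁)
include h

/-- Lifting incoming edges to `r⁻¹(w)` shows that the whole fibre over a range is reached; lifting
outgoing edges to `s⁻¹(w)` gives the lifting property. -/
theorem liesOver : (F.labelBy p₁).LiesOver E.toUltragraph p₀ where
  surjective := h.surjective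
  map_src f := (h.map_src f).symm
  mem_rng_iff a w := by
    constructor
    · intro hw
      obtain ⟨f, hf, rfl⟩ := (h.bijOn_rng w).surjOn (show a ∈ {e | E.rng e = p₀ w} from hw.symm)
      exact ⟨f, rfl, hf⟩
    · rintro ⟨f, rfl, rfl⟩
      exact (h.map_rng f).symm
  lift w a u ha hu := by
    obtain ⟨f, hf, rfl⟩ := (h.bijOn_src w).surjOn (show a ∈ {e | E.src e = p₀ w} from ha)
    exact ⟨f, hf, rfl, (h.map_rng f).symm.trans hu.symm⟩

theorem algebra_of_sets (L : LabelledSpace (F.labelBy p₁))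
    (hL : L.sets = {D | ∃ S, E.toUltragraph.Sets S ∧ D = p₀ ⁻¹' S}) :
    L.WeaklyLeftResolving ∧ Nonempty (L.CStar ≃⋆ₐ[ℂ] E.CStar) := by
  obtain ⟨φ⟩ := h.liesOver.nonempty_equiv hL
  obtain ⟨ψ⟩ := E.splits_toUltragraph.nonempty_equiv
  exact ⟨h.liesOver.weaklyLeftResolving L hL, ⟨φ.trans ψ⟩⟩

/-- Ranges in the ultragraph of `E` are singletons, so its `𝒢⁰` is the collection of all finite sets
of vertices. -/
theorem fibreSpace_algebra :
    h.fibreSpace.WeaklyLeftResolving ∧ Nonempty (h.fibreSpace.CStar ≃⋆ₐ[ℂ] E.CStar) := by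
  refine h.algebra_of_sets _ ?_
  ext D
  constructor
  · rintro ⟨S, hS, rfl⟩
    exact ⟨S, Ultragraph.sets_of_finite hS, rfl⟩
  · rintro ⟨S, hS, rfl⟩
    exact ⟨S, Ultragraph.finite_of_sets (fun _ => Set.finite_singleton _) hS, rfl⟩

theorem space_algebra (hiso : ∀ v w, (F.IsSource v ∨ F.IsSink v) → p₀ w = p₀ v → w = v) :
    (F.labelBy p₁).space.WeaklyLeftResolving ∧
      Nonempty ((F.labelBy p₁).space.CStar ≃⋆ₐ[ℂ] E.CStar) :=
  h.algebra_of_sets _ (h.liesOver.space_sets hiso)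

end IsCovering

/-! ### Labelled graphs of ultragraphs. -/

namespace Ultragraph

variable {V X : Type u} (𝒢 : Ultragraph V X)

theorem liesOver_labelledGraph : 𝒢.labelledGraph.LiesOver 𝒢 id where
  surjective := Function.surjective_id
  map_src _ := rfl
  mem_rng_iff a w := by
    constructor
    · intro hw
      exact ⟨⟨(a, w), hw⟩, rfl, rfl⟩
    · rintro ⟨f, rfl, rfl⟩
      exact f.2
  lift w a u ha hu := ⟨⟨(a, u), hu⟩, ha, rfl, rfl⟩

theorem labelledGraph_algebra :
    𝒢.labelledGraph.space.WeaklyLeftResolving ∧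
      Nonempty (𝒢.labelledGraph.space.CStar ≃⋆ₐ[ℂ] 𝒢.CStar) := by
  have h := 𝒢.liesOver_labelledGraph
  have hL := h.space_sets fun _ _ _ hw => hw
  exact ⟨h.weaklyLeftResolving _ hL, h.nonempty_equiv hL⟩

end Ultragraph

/-! ### Proper out-splittings. -/

namespace OutPartition

variable {V X : Type u} {E : DirectedGraph V X} (P : OutPartition E)

theorem exists_cell (c : P.Cell) : ∃ e, P.cell e = c := Quotient.exists_rep c

theorem base_surjective : Function.Surjective P.base := fun v => by
  by_cases hv : E.IsSink v
  · exact ⟨.inr ⟨v, hv⟩, rfl⟩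
  · rw [DirectedGraph.IsSink] at hv
    push Not at hv
    obtain ⟨e, rfl⟩ := hv
    exact ⟨.inl (P.cell e), rfl⟩

theorem eq_inr_of_base_eq {v : V} (hv : E.IsSink v) {x : P.Vertex} (hx : P.base x = v) :
    x = .inr ⟨v, hv⟩ := by
  subst hx
  rcases x with c | ⟨v, _⟩
  · obtain ⟨e, rfl⟩ := P.exists_cell c
    exact absurd rfl (hv e)
  · rfl

theorem exists_eq_inl_of_base_eq {v : V} (hv : ¬ E.IsSink v) {x : P.Vertex} (hx : P.base x = v) :
    ∃ c, x = .inl c ∧ P.cellSrc c = v := by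
  rcases x with c | ⟨w, hw⟩
  · exact ⟨c, rfl, hx⟩
  · exact absurd ((show w = v from hx) ▸ hw) hv

/-- The ultragraph of an out-splitting: the edge `e` emanates from its cell and ends in all
vertices arising from `r(e)`. -/
def ultragraph : Ultragraph P.Vertex X where
  src e := .inl (P.cell e)
  rng e := P.base ⁻¹' {E.rng e}
  rng_nonempty e := P.base_surjective (E.rng e)

theorem liesOver_outSplit : P.outSplit.LiesOver P.ultragraph id where
  surjective := Function.surjective_id
  map_src _ := rfl
  mem_rng_iff a w := by
    constructor
    · intro hw
      exact ⟨⟨(a, w), hw⟩, rfl, rfl⟩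
    · rintro ⟨f, rfl, rfl⟩
      exact f.2
  lift w a u ha hu := ⟨⟨(a, u), hu⟩, ha, rfl, rfl⟩

theorem setOf_src_inl (c : P.Cell) :
    {e | P.ultragraph.src e = .inl c} = {e | P.cell e = c} := by
  ext e
  exact Sum.inl_injective.eq_iff

theorem finite_fibre (hP : P.Proper) (v : V) : (P.base ⁻¹' {v}).Finite := by
  by_cases hv : E.IsSink v
  · exact (Set.finite_singleton _).subset fun x hx => P.eq_inr_of_base_eq hv hx
  · have hcells : {c | P.cellSrc c = v}.Finite := by
      by_cases hfin : {e | E.src e = v}.Finite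
      · refine (hfin.image P.cell).subset fun c hc => ?_
        obtain ⟨e, rfl⟩ := P.exists_cell c
        exact ⟨e, hc, rfl⟩
      · exact (hP v hfin).1
    refine (hcells.image Sum.inl).subset fun x hx => ?_
    obtain ⟨c, rfl, hc⟩ := P.exists_eq_inl_of_base_eq hv hx
    exact ⟨c, hc, rfl⟩

/-- The exceptional vertex over `v` is `v` itself for a sink, any vertex of the fibre if `v` emits
finitely many edges, and otherwise the unique infinite cell. -/
theorem exists_section (hP : P.Proper) (v : V) : ∃ x, P.base x = v ∧
    (∀ y, P.base y = v → y ≠ x → {e | P.ultragraph.src e = y}.Finite ∧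
      {e | P.ultragraph.src e = y}.Nonempty) ∧
    (¬ E.IsSink v → {e | P.ultragraph.src e = x}.Nonempty) := by
  have nonempty_inl : ∀ c, {e | P.ultragraph.src e = .inl c}.Nonempty := by
    intro c
    obtain ⟨e, rfl⟩ := P.exists_cell c
    exact ⟨e, rfl⟩
  by_cases hv : E.IsSink v
  · exact ⟨.inr ⟨v, hv⟩, rfl, fun y hy hne => absurd (P.eq_inr_of_base_eq hv hy) hne,
      fun h => absurd hv h⟩
  · by_cases hfin : {e | E.src e = v}.Finite
    · obtain ⟨x, hx⟩ := P.base_surjective v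
      refine ⟨x, hx, fun y hy _ => ?_, fun _ => ?_⟩
      · obtain ⟨c, rfl, hc⟩ := P.exists_eq_inl_of_base_eq hv hy
        refine ⟨?_, nonempty_inl c⟩
        rw [P.setOf_src_inl]
        refine hfin.subset ?_
        rintro e rfl
        exact hc
      · obtain ⟨c, rfl, -⟩ := P.exists_eq_inl_of_base_eq hv hx
        exact nonempty_inl c
    · obtain ⟨-, c, ⟨hc, -⟩, huniq⟩ := hP v hfin
      refine ⟨.inl c, hc, fun y hy hne => ?_, fun _ => nonempty_inl c⟩
      obtain ⟨c', rfl, hc'⟩ := P.exists_eq_inl_of_base_eq hv hy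
      refine ⟨?_, nonempty_inl c'⟩
      rw [P.setOf_src_inl]
      by_contra hinf
      exact hne (congrArg _ (huniq c' ⟨hc', hinf⟩))

theorem exists_splits (hP : P.Proper) : ∃ d, P.ultragraph.Splits E P.base d := by
  choose d hd hreg hne using P.exists_section hP
  exact ⟨d,
    { finite_fibre := P.finite_fibre hP
      base_section := hd
      base_src := fun _ => rfl
      rng_eq := fun _ => rfl
      finite_emit := fun x hx => (hreg _ x rfl hx).1
      nonempty_emit := fun x hx => (hreg _ x rfl hx).2
      nonempty_emit_section := fun v _ ⟨e, he⟩ => hne v fun hv => hv e he }⟩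

theorem outSplit_algebra (hP : P.Proper) :
    P.outSplit.space.WeaklyLeftResolving ∧
      Nonempty (P.outSplit.space.CStar ≃⋆ₐ[ℂ] E.CStar) := by
  have h := P.liesOver_outSplit
  have hL := h.space_sets fun _ _ _ hw => hw
  obtain ⟨φ⟩ := h.nonempty_equiv hL
  obtain ⟨d, hd⟩ := P.exists_splits hP
  obtain ⟨ψ⟩ := hd.nonempty_equiv
  exact ⟨h.weaklyLeftResolving _ hL, ⟨φ.trans ψ⟩⟩

end OutPartition

end LabelledGraphAlgebras

end

theorem proposition5p1 :
    -- (i) the trivial labelling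
    (∀ (V X : Type u) [Countable V] [Countable X]
      (E : LabelledGraphAlgebras.DirectedGraph V X),
      E.trivialLabelling.space.WeaklyLeftResolving ∧
      Nonempty (E.trivialLabelling.space.CStar ≃⋆ₐ[ℂ] E.CStar)) ∧
    -- (ii) ultragraphs
    (∀ (V X : Type u) [Countable V] [Countable X]
      (𝒢 : LabelledGraphAlgebras.Ultragraph V X),
      𝒢.labelledGraph.space.WeaklyLeftResolving ∧
      Nonempty (𝒢.labelledGraph.space.CStar ≃⋆ₐ[ℂ] 𝒢.CStar)) ∧
    -- (iii) coverings: for the collection of inverse images of finite sets of vertices, and for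
    -- the collection `ℱ⁰` if every source and every sink of `F` is alone in its fibre
    (∀ (V X W Y : Type u) [Countable V] [Countable X] [Countable W] [Countable Y]
      (F : LabelledGraphAlgebras.DirectedGraph W Y) (E : LabelledGraphAlgebras.DirectedGraph V X)
      (p₀ : W → V) (p₁ : Y → X) (h : LabelledGraphAlgebras.IsCovering F E p₀ p₁),
      (h.fibreSpace.WeaklyLeftResolving ∧ Nonempty (h.fibreSpace.CStar ≃⋆ₐ[ℂ] E.CStar)) ∧
      ((∀ v w, (F.IsSource v ∨ F.IsSink v) → p₀ w = p₀ v → w = v) →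
        (F.labelBy p₁).space.WeaklyLeftResolving ∧
        Nonempty ((F.labelBy p₁).space.CStar ≃⋆ₐ[ℂ] E.CStar))) ∧
    -- (iv) proper out-splittings
    (∀ (V X : Type u) [Countable V] [Countable X]
      (E : LabelledGraphAlgebras.DirectedGraph V X) (P : LabelledGraphAlgebras.OutPartition E),
      P.Proper →
        P.outSplit.space.WeaklyLeftResolving ∧
        Nonempty (P.outSplit.space.CStar ≃⋆ₐ[ℂ] E.CStar)) := by
  exact ⟨fun V X _ _ E => E.isCovering_id.space_algebra fun _ _ _ h => h,
    fun V X _ _ 𝒢 => 𝒢.labelledGraph_algebra,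
    fun V X W Y _ _ _ _ F E p₀ p₁ h => ⟨h.fibreSpace_algebra, h.space_algebra⟩,
    fun V X _ _ E P hP => P.outSplit_algebra hP⟩
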